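/- Let $Q$ be an infinite affine quiver, that is, a quiver with set of vertices $I$ obtained by choosing an arbitrary orientation of every edge of one of the graphs $A_\infty$ (the line $\cdots - (-1) - 0 - 1 - \cdots$ with vertex set $\mathbb{Z}$), $A_{+\infty}$ (the half line $0 - 1 - 2 - \cdots$), or $D_\infty$ (the half line $1 - 2 - 3 - \cdots$ with one more vertex $0$ joined to $2$). For an arrow $a$ write $t(a)$ for its tail and $h(a)$ for its head. Let $\hat{\mathbb{C}}^I$ be the space of all families $\lambda=(\lambda_i)_{i\in I}$ of complex numbers, let $\mathbb{N}^I$ be the set of finitely supported families $\alpha=(\alpha_i)_{i\in I}$ of non-negative integers (and $\mathbb{Z}^I$ the group of finitely supported families of integers), and put $\lambda\cdot\alpha=\sum_i\lambda_i\alpha_i$ and $$p(\alpha)=1+\sum_{a\in Q}\alpha_{t(a)}\alpha_{h(a)}-\sum_{i\in I}\alpha_i^2 .$$ Let $B=\prod_{i\in I}\mathbb{C}e_i$ and let $E$ be the $B$-bimodule of all (possibly infinite) formal linear combinations of the arrows of the double quiver $\overline{Q}$ (which has, besides every arrow $a:i\to j$ of $Q$, a reverse arrow $a^*:j\to i$),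 where $e_{h(a)}\,a\,e_{t(a)}=a$ for every arrow $a$ of $\overline{Q}$. The completed path algebra is the tensor algebra $T_BE=\bigoplus_{k\ge 0}T_B^kE$, with the linear topology in which the subspaces of finite codimension form a basis of the neighbourhoods of $0$. With $R_i=\sum_{a\in Q,\,h(a)=i}a\,a^*-\sum_{a\in Q,\,t(a)=i}a^*a$, the continuous deformed preprojective algebra $\hat\Pi_\lambda(Q)$ is the quotient of $T_BE$ by the closed two-sided ideal generated by the elements $R_i-\lambda_ie_i$, $i\in I$. A representation $M$ of $\hat\Pi_\lambda(Q)$ has dimension vector $\alpha\in\mathbb{N}^I$ if $M=\bigoplus_{i\in I}e_iM$ and $\dim_{\mathbb{C}}e_iM=\alpha_i$ for all $i$. Let $(\alpha,\beta)=\langle\alpha,\beta\rangle+\langle\beta,\alpha\rangle$ with $\langle\alpha,\beta\rangle=\sum_i\alpha_i\beta_i-\sum_{a\in Q}\alpha_{t(a)}\beta_{h(a)}$, let $\epsilon_i$ be the coordinate vectors, and let $W$ be the group generated by the reflections $s_i(\alpha)=\alpha-(\alpha,\epsilon_i)\epsilon_i$ of $\mathbb{Z}^I$. The roots of $Q$ are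 the vectors $w\epsilon_i$ ($w\in W$, $i\in I$) and the vectors $\pm w\beta$ ($w\in W$), where $\beta\in\mathbb{N}^I$ is non-zero with connected support and $(\beta,\epsilon_i)\le 0$ for all $i$; the roots of a full subquiver $Q_J$, $J\subset I$, are defined in the same way. A root is positive if all its coordinates are non-negative. For $\lambda\in\hat{\mathbb{C}}^I$ and $\alpha\in\mathbb{N}^I$ the following are equivalent: 1. There is a simple representation of $\hat\Pi_\lambda(Q)$ of dimension vector $\alpha$. 2. $\alpha$ is (the extension by zero of) a positive root of some finite connected full subquiver $Q_J$ of $Q$, $\lambda\cdot\alpha=0$, and $p(\alpha)>\sum_{k=1}^np(\beta^{(k)})$ for every decomposition $\alpha=\beta^{(1)}+\dots+\beta^{(n)}$ with $n\ge 2$ and all $\beta^{(k)}$ positive roots with $\lambda\cdot\beta^{(k)}=0$. Moreover, such a representation is unique up to isomorphism: any two simple representations of $\hat\Pi_\lambda(Q)$ of the same dimension vector $\alpha$ are isomorphic. -/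

import Mathlib

universe u v w w'

noncomputable section

namespace InfQuiver

open Quiver

/-! ## Infinite quivers of affine type -/

/-- The doubly infinite line `… - (-1) - 0 - 1 - 2 - …` (type `A_∞`). -/
def graphAInf : SimpleGraph ℤ :=
  SimpleGraph.fromRel fun i j => j = i + 1

/-- The half line `0 - 1 - 2 - …` (type `A_{+∞}`). -/
def graphAPlusInf : SimpleGraph ℕ :=
  SimpleGraph.fromRel fun i j => j = i + 1

/-- The half line `1 - 2 - 3 - …` with one more vertex `0` joined to `2` (type `D_∞`). -/
def graphDInf : SimpleGraph ℕ :=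
  SimpleGraph.fromRel fun i j => (i = 0 ∧ j = 2) ∨ (1 ≤ i ∧ j = i + 1)

/-- The quiver `I` is obtained from the simple graph `G` on its set of vertices by orienting every
edge: there is exactly one arrow (in one of the two directions) between adjacent vertices, and no
arrow between vertices that are not adjacent. -/
structure IsOrientationOf (I : Type u) [Quiver.{v} I] (G : SimpleGraph I) : Prop where
  of_adj : ∀ i j, G.Adj i j → Nonempty (Unique ((i ⟶ j) ⊕ (j ⟶ i)))
  of_not_adj : ∀ i j, ¬ G.Adj i j → IsEmpty ((i ⟶ j) ⊕ (j ⟶ i))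

/-- Infinite affine quivers: the quivers with arbitrary orientation whose underlying graph is
`A_∞`, `A_{+∞}` or `D_∞`. -/
def IsInfiniteAffine (I : Type u) [Quiver.{v} I] : Prop :=
  ∃ G : SimpleGraph I, IsOrientationOf I G ∧
    (Nonempty (G ≃g graphAInf) ∨ Nonempty (G ≃g graphAPlusInf) ∨ Nonempty (G ≃g graphDInf))

/-- The set of vertices `J` as the set of vertices of the full subquiver `Q_J`. The map `incl` is
the inclusion into the set of all vertices. -/
@[ext]
structure FullSubquiver {I : Type u} (J : Set I) : Type u where
  incl : I
  mem : incl ∈ J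

/-- The full subquiver: its arrows are all arrows between vertices in `J`. -/
instance {I : Type u} [Quiver.{v} I] (J : Set I) : Quiver.{v} (FullSubquiver J) where
  Hom i j := (i.incl ⟶ j.incl)

/-- Connectedness of the full subquiver with set of vertices `J`, regardless of the directions of
the arrows. (A connected graph is non-empty.) -/
def ConnectedOn {I : Type u} [Quiver.{v} I] (J : Set I) : Prop :=
  ((SimpleGraph.fromRel fun i j : I => Nonempty (i ⟶ j)).induce J).Connected

/-! ## The completed path algebra and the continuous deformed preprojective algebra -/

section Algebra

variable (I : Type u) [Quiver.{v} I]

/-- The algebra `B = ∏_{i ∈ I} ℂ`, topologically spanned by the idempotents `e_i`. -/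
abbrev VertexAlgebra : Type u := I → ℂ

/-- The set of arrows of the double quiver. The arrow `a : i ⟶ j` of the quiver gives the
arrows `a : i ⟶ j` and `a* : j ⟶ i`. -/
abbrev DoubleArrow : Type (max u v) := Quiver.Total (Quiver.Symmetrify I)

/-- The space `E = ∏_{i,j} E_{ij}` with topological basis the arrows of the double quiver. -/
abbrev ArrowSpace : Type (max u v) := DoubleArrow I → ℂ

variable {I}

/-- The head of an arrow of the double quiver. -/
def head (a : DoubleArrow I) : I := a.right

/-- The tail of an arrow of the double quiver. -/
def tail (a : DoubleArrow I) : I := a.left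

/-- The left action of `B` on `E`: `e_i a = a` if `i = h(a)`, and `e_i a = 0` otherwise. -/
def lact (b : VertexAlgebra I) (x : ArrowSpace I) : ArrowSpace I := fun a => b (head a) * x a

/-- The right action of `B` on `E`: `a e_i = a` if `i = t(a)`, and `a e_i = 0` otherwise. -/
def ract (x : ArrowSpace I) (b : VertexAlgebra I) : ArrowSpace I := fun a => x a * b (tail a)

/-- The relations that make the tensor algebra of the complex vector space `B × E` into the tensor
algebra `T_B E` of the `B`-bimodule `E`: the map from `B` is a homomorphism of unital algebras,
and the map from `E` is a homomorphism of `B`-bimodules. -/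
inductive TensorRel : TensorAlgebra ℂ (VertexAlgebra I × ArrowSpace I) →
    TensorAlgebra ℂ (VertexAlgebra I × ArrowSpace I) → Prop
  | one : TensorRel (TensorAlgebra.ι ℂ (1, 0)) 1
  | mul (b c : VertexAlgebra I) :
      TensorRel (TensorAlgebra.ι ℂ (b * c, 0))
        (TensorAlgebra.ι ℂ (b, 0) * TensorAlgebra.ι ℂ (c, 0))
  | left (b : VertexAlgebra I) (x : ArrowSpace I) :
      TensorRel (TensorAlgebra.ι ℂ (0, lact b x))
        (TensorAlgebra.ι ℂ (b, 0) * TensorAlgebra.ι ℂ (0, x))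
  | right (x : ArrowSpace I) (b : VertexAlgebra I) :
      TensorRel (TensorAlgebra.ι ℂ (0, ract x b))
        (TensorAlgebra.ι ℂ (0, x) * TensorAlgebra.ι ℂ (b, 0))

variable (I)

/-- The completed path algebra `T_B E` of the double quiver. -/
abbrev CompletedPathAlgebra : Type (max u v) := RingQuot (TensorRel (I := I))

variable {I}

/-- The canonical map `B → T_B E`. -/
def ofVertex (b : VertexAlgebra I) : CompletedPathAlgebra I :=
  RingQuot.mkAlgHom ℂ TensorRel (TensorAlgebra.ι ℂ (b, 0))

/-- The canonical map `E → T_B E`. -/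
def ofArrow (x : ArrowSpace I) : CompletedPathAlgebra I :=
  RingQuot.mkAlgHom ℂ TensorRel (TensorAlgebra.ι ℂ (0, x))

open Classical in
/-- The idempotent `e_i`, the trivial path at the vertex `i`. -/
def idem (i : I) : CompletedPathAlgebra I := ofVertex (Pi.single i 1)

open Classical in
/-- The arrow `a : i ⟶ j` of the quiver as an element of the completed path algebra. -/
def arrow {i j : I} (a : i ⟶ j) : CompletedPathAlgebra I :=
  ofArrow (Pi.single (⟨i, j, Sum.inl a⟩ : DoubleArrow I) 1)

open Classical in
/-- The reverse arrow `a* : j ⟶ i` of `a : i ⟶ j` as an element of the completed path algebra. -/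
def arrowStar {i j : I} (a : i ⟶ j) : CompletedPathAlgebra I :=
  ofArrow (Pi.single (⟨j, i, Sum.inr a⟩ : DoubleArrow I) 1)

/-- The element `R_i = ∑_{h(a) = i} a a* - ∑_{t(a) = i} a* a`. In a locally finite quiver the two
sums are finite. -/
def relator (i : I) : CompletedPathAlgebra I :=
  (∑ᶠ a : Quiver.Costar i, arrow a.2 * arrowStar a.2) -
    ∑ᶠ a : Quiver.Star i, arrowStar a.2 * arrow a.2

/-- The linear topology of a complex vector space in which the subspaces of finite codimension
form a basis of the neighbourhoods of `0`. -/
@[reducible] def finiteCodimTopology (A : Type w) [AddCommGroup A] [Module ℂ A] : TopologicalSpace A where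
  IsOpen U := ∀ x ∈ U, ∃ V : Submodule ℂ A, V.CoFG ∧ ∀ y ∈ V, x + y ∈ U
  isOpen_univ := fun _ _ => ⟨⊤, Submodule.CoFG.top, fun _ _ => Set.mem_univ _⟩
  isOpen_inter := by
    rintro U₁ U₂ h₁ h₂ x ⟨hx₁, hx₂⟩
    obtain ⟨V₁, c₁, hV₁⟩ := h₁ x hx₁
    obtain ⟨V₂, c₂, hV₂⟩ := h₂ x hx₂
    exact ⟨V₁ ⊓ V₂, c₁.inf c₂, fun y hy => ⟨hV₁ y hy.1, hV₂ y hy.2⟩⟩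
  isOpen_sUnion := by
    rintro S hS x ⟨U, hU, hx⟩
    obtain ⟨V, c, hV⟩ := hS U hU x hx
    exact ⟨V, c, fun y hy => ⟨U, hU, hV y hy⟩⟩

/-- The closed two-sided ideal of the completed path algebra generated by the elements
`R_i - λ_i e_i`. -/
def relationIdeal (lam : I → ℂ) : TwoSidedIdeal (CompletedPathAlgebra I) :=
  sInf {K | (∀ i, relator i - lam i • idem i ∈ K) ∧
    @IsClosed _ (finiteCodimTopology (CompletedPathAlgebra I)) (K : Set (CompletedPathAlgebra I))}

/-- The continuous deformed preprojective algebra `Π̂_λ(Q)`. -/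
abbrev ContPreprojective (lam : I → ℂ) : Type (max u v) := (relationIdeal lam).ringCon.Quotient

/-- The image of the idempotent `e_i` in `Π̂_λ(Q)`. -/
def vertexIdem (lam : I → ℂ) (i : I) : ContPreprojective lam :=
  (relationIdeal lam).ringCon.mk' (idem i)

section Representation

variable (lam : I → ℂ) (M : Type w) [AddCommGroup M] [Module ℂ M] [Module (ContPreprojective lam) M]
  [IsScalarTower ℂ (ContPreprojective lam) M]

/-- The space `M_i = e_i M` of the representation `M` at the vertex `i`. -/
def vertexSpace (i : I) : Submodule ℂ M :=
  LinearMap.range (Algebra.lsmul ℂ ℂ M (vertexIdem lam i))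

/-- The representation `M` has dimension vector `α`: it is the direct sum of the spaces
`M_i = e_i M`, and `dim M_i = α_i` for every vertex `i`. -/
structure HasDimensionVector (α : I →₀ ℕ) : Prop where
  independent : iSupIndep (vertexSpace lam M)
  iSup_eq_top : ⨆ i, vertexSpace lam M i = ⊤
  rank_eq : ∀ i, Module.rank ℂ (vertexSpace lam M i) = (α i : Cardinal)

end Representation

end Algebra

/-! ## The root system -/

section Roots

variable {I : Type u} [Quiver.{v} I]

/-- The Ringel form `⟨α, β⟩ = ∑_i α_i β_i - ∑_a α_{t(a)} β_{h(a)}` on `ℤ^I`. In a locally finite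
quiver both sums are finite. -/
def ringelForm (α β : I →₀ ℤ) : ℤ :=
  (α.sum fun i n => n * β i) - ∑ᶠ a : Quiver.Total I, α a.left * β a.right

/-- The symmetrized Ringel form. -/
def symForm (α β : I →₀ ℤ) : ℤ := ringelForm α β + ringelForm β α

/-- The simple root `ε_i`. -/
def simpleRoot (i : I) : I →₀ ℤ := Finsupp.single i 1

/-- The simple reflection `s_i(α) = α - (α, ε_i) ε_i`. -/
def simpleReflection (i : I) (α : I →₀ ℤ) : I →₀ ℤ := α - symForm α (simpleRoot i) • simpleRoot i

variable (I) in
/-- The Weyl group: the group of linear automorphisms generated by the simple reflections. -/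
def weylGroup : Subgroup ((I →₀ ℤ) ≃ₗ[ℤ] (I →₀ ℤ)) :=
  Subgroup.closure {s | ∃ i, ∀ α, s α = simpleReflection i α}

/-- Real roots: the elements of the orbits of the simple roots under the Weyl group. -/
def IsRealRoot (α : I →₀ ℤ) : Prop := ∃ s ∈ weylGroup I, ∃ i, α = s (simpleRoot i)

variable (I) in
/-- The fundamental region: the non-zero vectors `β` with non-negative coordinates and connected
support such that `(β, ε_i) ≤ 0` for all `i`. -/
def fundamentalRegion : Set (I →₀ ℤ) :=
  {β | (∀ i, 0 ≤ β i) ∧ β ≠ 0 ∧ ConnectedOn (β.support : Set I) ∧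
    ∀ i, symForm β (simpleRoot i) ≤ 0}

/-- Imaginary roots: the vectors `± s β` with `s` in the Weyl group and `β` in the fundamental
region. -/
def IsImaginaryRoot (α : I →₀ ℤ) : Prop :=
  ∃ s ∈ weylGroup I, ∃ β ∈ fundamentalRegion I, α = s β ∨ α = -s β

/-- Roots. -/
def IsRoot (α : I →₀ ℤ) : Prop := IsRealRoot α ∨ IsImaginaryRoot α

/-- Positive roots: the vectors `α ∈ ℕ^I` that are roots. -/
def IsPositiveRoot (α : I →₀ ℕ) : Prop := IsRoot (α.mapRange (fun n : ℕ => (n : ℤ)) Nat.cast_zero)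

/-- The function `p(α) = 1 + ∑_a α_{t(a)} α_{h(a)} - ∑_i α_i²`. -/
def pFun (α : I →₀ ℕ) : ℤ :=
  1 + (∑ᶠ a : Quiver.Total I, (α a.left : ℤ) * (α a.right : ℤ)) - α.sum fun _ n => (n : ℤ) ^ 2

end Roots

/-- The pairing `λ · α = ∑_i λ_i α_i`. -/
def pairing {I : Type u} (lam : I → ℂ) (α : I →₀ ℕ) : ℂ := α.sum fun i n => lam i * (n : ℂ)

/-- The vector `α` is (the extension by zero of) a positive root of a finite connected full
subquiver `Q_J`, and `λ_J · α = 0`. -/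
def IsFiniteTypeRoot {I : Type u} [Quiver.{v} I] (lam : I → ℂ) (α : I →₀ ℕ) : Prop :=
  ∃ J : Set I, J.Finite ∧ ConnectedOn J ∧ ∃ γ : FullSubquiver J →₀ ℕ,
    IsPositiveRoot γ ∧ γ.mapDomain FullSubquiver.incl = α ∧
      pairing (fun j : FullSubquiver J => lam j.incl) γ = 0

end InfQuiver

end

open InfQuiver

/-! The graphs in question carry a positive definite Ringel form q: in suitable coordinates 2q is a
sum of squares. So there are no imaginary roots, the positive roots are exactly the vectors of `ℕ^I`
with (α, α) = 2 (`isPositiveRoot_iff`), and p vanishes on all of them. The strict inequality in the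
second condition could then only read 0 > 0, so that condition says: α is a positive root with λ · α
= 0 that is not a sum of two or more positive roots orthogonal to λ.

Two facts about finite-dimensional representations M, N of dimension vectors α, β carry the
argument. One is the inequality (α, β) ≤ dim Hom(M, N) + dim Hom(N, M), `MomentRep.symForm_le`.
Homomorphisms form the kernel of a differential from vertex maps to arrow maps, and the images of
the differentials in the two directions are orthogonal under a nondegenerate trace pairing; counting
dimensions gives the bound. The other is `MomentRep.exists_hasDim`: every positive root orthogonal
to λ is a dimension vector. It is proved by induction on the height, adding a one-dimensional
summand at i when λ_i = 0 and applying a reflection functor when λ_i ≠ 0.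

If M is simple, Schur's lemma and the inequality give (α, α) ≤ 2, so α is a root; taking the trace
of the relations gives λ · α = 0. If α were a sum of several roots β_k orthogonal to λ, some (α,
β_k) would be positive, and a nonzero homomorphism between M and a representation of dimension
vector β_k would make M its subobject or quotient, although its dimension is smaller than that of M.
Conversely, the composition factors of a representation of dimension vector α are simple, so their
dimension vectors decompose α into roots orthogonal to λ; if α is indecomposable there is only one
factor. Finally (α, α) > 0 yields a nonzero map between two simple representations of the same
dimension vector, which is an isomorphism.

The topology enters only through finite-dimensionality: kernels of finite-dimensional actions are
closed, and infinite combinations act through finite sums. -/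

noncomputable section

namespace InfQuiver

open Quiver

/-! ### Arrows of the double quiver and finite sums over them -/

section DoubleQuiver

variable {I : Type u} [Quiver.{v} I]

/-- The reverse `a*` of an arrow `a` of the double quiver. -/
def reverseArrow (a : DoubleArrow I) : DoubleArrow I := ⟨a.right, a.left, Quiver.reverse a.hom⟩

@[simp] lemma head_reverseArrow (a : DoubleArrow I) : head (reverseArrow a) = tail a := rfl

@[simp] lemma tail_reverseArrow (a : DoubleArrow I) : tail (reverseArrow a) = head a := rfl

@[simp] lemma reverseArrow_reverseArrow (a : DoubleArrow I) :
    reverseArrow (reverseArrow a) = a := by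
  rcases a with ⟨i, j, h | h⟩ <;> rfl

/-- The sign of an arrow of the double quiver: `1` for the arrows of the quiver and `-1` for their
reverses. -/
def arrowSign (a : DoubleArrow I) : ℂ := Sum.elim (fun _ => 1) (fun _ => -1) a.hom

@[simp] lemma arrowSign_reverseArrow (a : DoubleArrow I) :
    arrowSign (reverseArrow a) = -arrowSign a := by
  rcases a with ⟨i, j, h | h⟩ <;> simp [arrowSign, reverseArrow]

@[simp] lemma arrowSign_mul_self (a : DoubleArrow I) : arrowSign a * arrowSign a = 1 := by
  rcases a with ⟨i, j, h | h⟩ <;> simp [arrowSign]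

lemma arrowSign_ne_zero (a : DoubleArrow I) : arrowSign a ≠ 0 :=
  left_ne_zero_of_mul_eq_one (arrowSign_mul_self a)

variable (I) in
/-- Local finiteness of a quiver. -/
class LocallyFiniteQuiver : Prop where
  finite_head_eq : ∀ i : I, {a : DoubleArrow I | head a = i}.Finite

variable [LocallyFiniteQuiver I]

/-- The arrows of the double quiver with head `i`. -/
def inArrows (i : I) : Finset (DoubleArrow I) :=
  (LocallyFiniteQuiver.finite_head_eq i).toFinset

@[simp] lemma mem_inArrows {i : I} {a : DoubleArrow I} : a ∈ inArrows i ↔ head a = i := by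
  simp [inArrows]

open Classical in
/-- The arrows of the double quiver between vertices in `s`. -/
def arrowsIn (s : Finset I) : Finset (DoubleArrow I) :=
  (s.biUnion inArrows).filter fun a => tail a ∈ s

@[simp] lemma mem_arrowsIn {s : Finset I} {a : DoubleArrow I} :
    a ∈ arrowsIn s ↔ head a ∈ s ∧ tail a ∈ s := by
  simp [arrowsIn]

lemma sum_arrowsIn_reverse {A : Type*} [AddCommMonoid A] (s : Finset I) (f : DoubleArrow I → A) :
    ∑ a ∈ arrowsIn s, f (reverseArrow a) = ∑ a ∈ arrowsIn s, f a :=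
  Finset.sum_nbij' reverseArrow reverseArrow (by simp [and_comm]) (by simp [and_comm])
    (by simp) (by simp) (by simp)

lemma sum_arrowsIn_of_tail {A : Type*} [AddCommMonoid A] (s : Finset I) (f : DoubleArrow I → A)
    (hf : ∀ a, tail a ∉ s → f a = 0) :
    ∑ a ∈ arrowsIn s, f a = ∑ i ∈ s, ∑ a ∈ inArrows i, f a := by
  classical
  rw [← Finset.sum_biUnion]
  · rw [arrowsIn, Finset.sum_filter_of_ne]
    intro a _ h
    by_contra h'
    exact h (hf a h')
  · intro i _ j _ hij
    rw [Function.onFun, Finset.disjoint_left]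
    intro a ha hb
    exact hij ((mem_inArrows.1 ha).symm.trans (mem_inArrows.1 hb))

/-- The arrows of the double quiver with head `i` are the arrows with head `i` and the reverses of
the arrows with tail `i`. -/
def costarSumStarEquiv (i : I) : Quiver.Costar i ⊕ Quiver.Star i ≃ {a // a ∈ inArrows i} :=
  Equiv.ofBijective
    (Sum.elim (fun a => ⟨⟨a.1, i, Sum.inl a.2⟩, by simp [head]⟩)
      (fun a => ⟨⟨a.1, i, Sum.inr a.2⟩, by simp [head]⟩)) <| by
    constructor
    · rintro (⟨j, a⟩ | ⟨j, a⟩) (⟨k, b⟩ | ⟨k, b⟩) h <;>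
      · have h' := congrArg (fun x => x.1.left) h
        obtain rfl : j = k := h'
        first | (cases h; rfl) | cases h
    · rintro ⟨⟨j, k, a⟩, h⟩
      obtain rfl : k = i := mem_inArrows.1 h
      rcases a with a | a
      · exact ⟨Sum.inl ⟨j, a⟩, rfl⟩
      · exact ⟨Sum.inr ⟨j, a⟩, rfl⟩

lemma sum_inArrows {A : Type*} [AddCommMonoid A] (i : I) (f : DoubleArrow I → A) :
    ∑ a ∈ inArrows i, f a = (∑ᶠ a : Quiver.Costar i, f ⟨a.1, i, Sum.inl a.2⟩) +
      ∑ᶠ a : Quiver.Star i, f ⟨a.1, i, Sum.inr a.2⟩ := by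
  have := Finite.of_equiv _ (costarSumStarEquiv i).symm
  have h1 : Finite (Quiver.Costar i) := Finite.sum_left (Quiver.Star i)
  have h2 : Finite (Quiver.Star i) := Finite.sum_right (Quiver.Costar i)
  have := Fintype.ofFinite (Quiver.Costar i)
  have := Fintype.ofFinite (Quiver.Star i)
  rw [finsum_eq_sum_of_fintype, finsum_eq_sum_of_fintype, ← Finset.sum_coe_sort,
    ← (costarSumStarEquiv i).sum_comp, Fintype.sum_sum_type]
  rfl

lemma finite_total_of_head_mem (s : Finset I) : {a : Quiver.Total I | a.right ∈ s}.Finite := by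
  have : Set.InjOn (fun a : Quiver.Total I => (⟨a.left, a.right, Sum.inl a.hom⟩ : DoubleArrow I))
      {a : Quiver.Total I | a.right ∈ s} := by
    rintro ⟨i, j, a⟩ _ ⟨k, l, b⟩ _ h
    obtain ⟨rfl, rfl, h⟩ := h
    rfl
  refine Set.Finite.of_finite_image ?_ this
  refine (s.finite_toSet.biUnion fun i _ => LocallyFiniteQuiver.finite_head_eq i).subset ?_
  rintro _ ⟨a, ha, rfl⟩
  simp only [Set.mem_iUnion]
  exact ⟨a.right, ha, rfl⟩

/-- Sums over the arrows of the double quiver in terms of the arrows of the quiver. -/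
lemma sum_arrowsIn_eq_finsum {A : Type*} [AddCommMonoid A] (s : Finset I) (f : I → I → A)
    (hf : ∀ i j, i ∉ s ∨ j ∉ s → f i j = 0) :
    ∑ a ∈ arrowsIn s, f (tail a) (head a) =
      (∑ᶠ a : Quiver.Total I, f a.left a.right) + ∑ᶠ a : Quiver.Total I, f a.right a.left := by
  classical
  set S : Finset (Quiver.Total I) :=
    (finite_total_of_head_mem s).toFinset.filter fun a => a.left ∈ s with hS
  have hS' : ∀ a, a ∈ S ↔ a.right ∈ s ∧ a.left ∈ s := by simp [hS]
  rw [finsum_eq_sum_of_support_subset (s := S), finsum_eq_sum_of_support_subset (s := S)]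
  · have : arrowsIn s = S.image (fun a => (⟨a.left, a.right, Sum.inl a.hom⟩ : DoubleArrow I)) ∪
        S.image (fun a => (⟨a.right, a.left, Sum.inr a.hom⟩ : DoubleArrow I)) := by
      ext ⟨i, j, a⟩
      rw [mem_arrowsIn, Finset.mem_union, Finset.mem_image, Finset.mem_image]
      constructor
      · rintro ⟨h1, h2⟩
        rcases a with a | a
        · exact Or.inl ⟨⟨i, j, a⟩, (hS' _).2 ⟨h1, h2⟩, rfl⟩
        · exact Or.inr ⟨⟨j, i, a⟩, (hS' _).2 ⟨h2, h1⟩, rfl⟩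
      · rintro (⟨b, hb, h⟩ | ⟨b, hb, h⟩)
        · rw [← h]; exact (hS' _).1 hb
        · rw [← h]; exact ((hS' _).1 hb).symm
    rw [this, Finset.sum_union, Finset.sum_image, Finset.sum_image]
    · rfl
    · rintro ⟨i, j, a⟩ _ ⟨k, l, b⟩ _ h
      obtain ⟨rfl, rfl, h⟩ := h
      rfl
    · rintro ⟨i, j, a⟩ _ ⟨k, l, b⟩ _ h
      obtain ⟨rfl, rfl, h⟩ := h
      rfl
    · rw [Finset.disjoint_left]
      rintro _ h1 h2
      obtain ⟨⟨i, j, a⟩, _, rfl⟩ := Finset.mem_image.1 h1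
      obtain ⟨⟨k, l, b⟩, _, h⟩ := Finset.mem_image.1 h2
      obtain ⟨rfl, rfl, h⟩ := h
  all_goals
    intro a ha
    rw [Finset.mem_coe, hS']
    by_contra h
    exact ha (hf _ _ (by tauto))

open Classical in
/-- An arrow of the double quiver as an element of the completed path algebra. -/
def arrowElem (a : DoubleArrow I) : CompletedPathAlgebra I := ofArrow (Pi.single a 1)

/-- Recording the orientation in a sign turns the two sums into one over the double quiver, where
reversing arrows is a symmetry. All later computations use this form. -/
lemma relator_eq_sum (i : I) :
    relator i = ∑ a ∈ inArrows i, arrowSign a • (arrowElem a * arrowElem (reverseArrow a)) := by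
  rw [sum_inArrows, relator, sub_eq_add_neg, ← finsum_neg_distrib]
  refine congrArg₂ _ ?_ ?_
  · refine finsum_congr fun a => ?_
    simp only [arrowSign, Sum.elim_inl, one_smul]
    rfl
  · refine finsum_congr fun a => ?_
    simp only [arrowSign, Sum.elim_inr]
    exact (neg_one_smul ℂ _).symm

end DoubleQuiver

/-! ### The symmetrized Ringel form -/

section Forms

variable {I : Type u}

/-- The inclusion of `ℕ^I` into `ℤ^I`. -/
def toIntVec (α : I →₀ ℕ) : I →₀ ℤ := α.mapRange (fun n : ℕ => (n : ℤ)) Nat.cast_zero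

@[simp] lemma toIntVec_apply (α : I →₀ ℕ) (i : I) : toIntVec α i = α i := rfl

variable [Quiver.{v} I]

lemma symForm_comm (α β : I →₀ ℤ) : symForm α β = symForm β α := by
  rw [symForm, symForm, add_comm]

lemma symForm_self (α : I →₀ ℤ) : symForm α α = 2 * ringelForm α α := by rw [symForm, two_mul]

variable [LocallyFiniteQuiver I]

/-- Symmetrizing the form amounts to doubling the quiver. The freedom to enlarge s lets vectors with
different supports be compared. -/
lemma symForm_eq {α β : I →₀ ℤ} (s : Finset I) (hα : α.support ⊆ s) (hβ : β.support ⊆ s) :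
    symForm α β = 2 * ∑ i ∈ s, α i * β i - ∑ a ∈ arrowsIn s, α (tail a) * β (head a) := by
  have h0 : ∀ i, i ∉ s → α i = 0 := fun i hi =>
    Finsupp.notMem_support_iff.1 fun h => hi (hα h)
  have h0' : ∀ i, i ∉ s → β i = 0 := fun i hi =>
    Finsupp.notMem_support_iff.1 fun h => hi (hβ h)
  have h1 : (α.sum fun i n => n * β i) = ∑ i ∈ s, α i * β i :=
    Finsupp.sum_of_support_subset _ hα _ (by simp)
  have h2 : (β.sum fun i n => n * α i) = ∑ i ∈ s, α i * β i := by
    rw [Finsupp.sum_of_support_subset _ hβ _ (by simp)]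
    exact Finset.sum_congr rfl fun i _ => mul_comm _ _
  rw [symForm, ringelForm, ringelForm, h1, h2,
    sum_arrowsIn_eq_finsum s (fun i j => α i * β j)
      (by rintro i j (h | h) <;> simp [h0, h0', h])]
  simp only [mul_comm (β _)]
  ring

lemma symForm_add_left (α α' β : I →₀ ℤ) :
    symForm (α + α') β = symForm α β + symForm α' β := by
  classical
  have h := Finsupp.support_add (g₁ := α) (g₂ := α')
  rw [symForm_eq (α.support ∪ α'.support ∪ β.support) (h.trans Finset.subset_union_left)
      Finset.subset_union_right,
    symForm_eq (α.support ∪ α'.support ∪ β.support) (by grind) (by grind),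
    symForm_eq (α.support ∪ α'.support ∪ β.support) (by grind) (by grind)]
  simp only [Finsupp.add_apply, add_mul, Finset.sum_add_distrib]
  ring

lemma symForm_smul_left (c : ℤ) (α β : I →₀ ℤ) : symForm (c • α) β = c * symForm α β := by
  classical
  have h := Finsupp.support_smul (b := c) (g := α)
  rw [symForm_eq (α.support ∪ β.support) (h.trans Finset.subset_union_left)
      Finset.subset_union_right,
    symForm_eq (α.support ∪ β.support) (by grind) (by grind)]
  simp only [Finsupp.smul_apply, smul_eq_mul, mul_assoc, ← Finset.mul_sum]
  ring

/-- The symmetrized Ringel form as a bilinear map. -/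
def symFormBilin : (I →₀ ℤ) →ₗ[ℤ] (I →₀ ℤ) →ₗ[ℤ] ℤ :=
  LinearMap.mk₂ ℤ symForm symForm_add_left (fun c α β => by simp [symForm_smul_left])
    (fun α β β' => by rw [symForm_comm, symForm_add_left, symForm_comm β, symForm_comm β'])
    (fun c α β => by rw [symForm_comm, symForm_smul_left, symForm_comm β, smul_eq_mul])

@[simp] lemma symFormBilin_apply (α β : I →₀ ℤ) : symFormBilin α β = symForm α β := rfl

lemma symForm_simpleRoot (α : I →₀ ℤ) (i : I) :
    symForm α (simpleRoot i) = 2 * α i - ∑ a ∈ inArrows i, α (tail a) := by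
  classical
  have h : (simpleRoot i).support ⊆ insert i α.support :=
    Finsupp.support_single_subset.trans (by simp)
  rw [symForm_eq (insert i α.support) (by grind) h]
  congr 1
  · rw [Finset.sum_eq_single i] <;> simp +contextual [simpleRoot, eq_comm]
  · rw [sum_arrowsIn_of_tail, Finset.sum_eq_single i]
    · refine Finset.sum_congr rfl fun a ha => ?_
      rw [mem_inArrows] at ha
      simp [simpleRoot, ha]
    · intro j _ hj
      refine Finset.sum_eq_zero fun a ha => ?_
      rw [mem_inArrows] at ha
      simp [simpleRoot, ha, hj]
    · simp
    · intro a ha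
      have : α (tail a) = 0 := by simp_all
      simp [this]

end Forms

/-! ### Roots of a quiver with positive definite form -/

section DefiniteForm

variable {I : Type u}

@[simp] lemma toIntVec_zero : toIntVec (0 : I →₀ ℕ) = 0 := by
  ext; simp

lemma toIntVec_add (α β : I →₀ ℕ) : toIntVec (α + β) = toIntVec α + toIntVec β := by
  ext; simp

lemma toIntVec_single (i : I) : toIntVec (Finsupp.single i 1) = simpleRoot i := by
  classical
  ext j
  simp only [toIntVec_apply, simpleRoot, Finsupp.single_apply]
  split_ifs <;> simp

lemma toIntVec_injective : Function.Injective (toIntVec (I := I)) := by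
  intro α β h
  ext i
  simpa using DFunLike.congr_fun h i

lemma toIntVec_sum {ι : Type*} (s : Finset ι) (β : ι → I →₀ ℕ) :
    toIntVec (∑ k ∈ s, β k) = ∑ k ∈ s, toIntVec (β k) := by
  ext; simp [Finsupp.finsetSum_apply]

lemma support_toIntVec (α : I →₀ ℕ) : (toIntVec α).support = α.support := by
  ext; simp

variable [Quiver.{v} I]

variable (I) in
/-- Quivers whose Ringel form is positive definite. -/
class DefiniteQuiver : Prop where
  ringelForm_pos : ∀ α : I →₀ ℤ, α ≠ 0 → 0 < ringelForm α α

lemma pFun_eq (α : I →₀ ℕ) : pFun α = 1 - ringelForm (toIntVec α) (toIntVec α) := by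
  have : ((toIntVec α).sum fun i n => n * toIntVec α i) = α.sum fun _ n => (n : ℤ) ^ 2 := by
    rw [toIntVec, Finsupp.sum_mapRange_index (by simp)]
    exact Finsupp.sum_congr fun i _ => by rw [Finsupp.mapRange_apply, sq]
  rw [pFun, ringelForm, this]
  simp only [toIntVec_apply]
  ring

/-- The form is even as well as positive definite. -/
lemma two_le_symForm_self [DefiniteQuiver I] {α : I →₀ ℤ} (h : α ≠ 0) : 2 ≤ symForm α α := by
  have := DefiniteQuiver.ringelForm_pos α h
  rw [symForm_self]
  lia

variable [LocallyFiniteQuiver I]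

lemma symForm_toIntVec_right (α : I →₀ ℤ) (β : I →₀ ℕ) :
    symForm α (toIntVec β) = ∑ i ∈ β.support, (β i : ℤ) * symForm α (simpleRoot i) := by
  have h : toIntVec β = ∑ i ∈ β.support, (β i : ℤ) • simpleRoot i := by
    conv_lhs => rw [← Finsupp.sum_single (toIntVec β)]
    rw [Finsupp.sum, support_toIntVec]
    exact Finset.sum_congr rfl fun i _ => by simp [simpleRoot]
  rw [h, ← symFormBilin_apply, map_sum]
  simp

variable [DefiniteQuiver I]

/-- A loop at i could only lower the value below 2, which definiteness forbids. -/
lemma symForm_simpleRoot_self (i : I) : symForm (simpleRoot i) (simpleRoot i) = 2 := by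
  classical
  refine le_antisymm ?_ (two_le_symForm_self (by simp [simpleRoot]))
  rw [symForm_simpleRoot]
  have : 0 ≤ ∑ a ∈ inArrows i, simpleRoot i (tail a) :=
    Finset.sum_nonneg fun a _ => by
      rw [simpleRoot, Finsupp.single_apply]
      split_ifs <;> simp
  simp only [simpleRoot, Finsupp.single_eq_same] at *
  lia

lemma tail_ne_head (a : DoubleArrow I) : tail a ≠ head a := by
  classical
  intro h
  have h1 := symForm_simpleRoot_self (head a)
  rw [symForm_simpleRoot] at h1
  have h2 : 0 < ∑ b ∈ inArrows (head a), simpleRoot (head a) (tail b) := by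
    refine Finset.sum_pos' (fun b _ => ?_) ⟨a, by simp, by simp [h, simpleRoot]⟩
    rw [simpleRoot, Finsupp.single_apply]
    split_ifs <;> simp
  simp only [simpleRoot, Finsupp.single_eq_same] at *
  lia

/-- The nonzero vector α - ε_i has square length 4 - 2(α, ε_i), and this is at least 2. -/
lemma symForm_simpleRoot_le_one {α : I →₀ ℤ} (hα : symForm α α = 2) {i : I}
    (hi : α ≠ simpleRoot i) : symForm α (simpleRoot i) ≤ 1 := by
  have h := two_le_symForm_self (sub_ne_zero.2 hi)
  rw [← symFormBilin_apply] at h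
  simp only [map_sub, LinearMap.sub_apply, symFormBilin_apply, hα, symForm_simpleRoot_self,
    symForm_comm (simpleRoot i) α] at h
  lia

/-- The positive number (α, α) is the sum of the α_i (α, ε_i), so one of these terms is positive. -/
lemma exists_symForm_simpleRoot_pos {α : I →₀ ℕ} (hα : α ≠ 0) :
    ∃ i, 0 < α i ∧ 0 < symForm (toIntVec α) (simpleRoot i) := by
  by_contra! h
  have h1 := two_le_symForm_self (α := toIntVec α) fun h =>
    hα (toIntVec_injective (h.trans toIntVec_zero.symm))
  rw [symForm_toIntVec_right] at h1
  have : ∑ i ∈ α.support, (α i : ℤ) * symForm (toIntVec α) (simpleRoot i) ≤ 0 :=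
    Finset.sum_nonpos fun i hi =>
      mul_nonpos_of_nonneg_of_nonpos (by simp)
        (h i (Nat.pos_of_ne_zero (Finsupp.mem_support_iff.1 hi)))
  lia

/-- A positive vector of square length `2` other than a simple root is the image of a smaller such
vector under a simple reflection. -/
lemma exists_add_single {α : I →₀ ℕ} (hα : symForm (toIntVec α) (toIntVec α) = 2) :
    ∃ i, α = Finsupp.single i 1 ∨
      ∃ β, α = β + Finsupp.single i 1 ∧ symForm (toIntVec β) (toIntVec β) = 2 ∧
        symForm (toIntVec β) (simpleRoot i) = -1 := by
  have h0 : α ≠ 0 := by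
    rintro rfl
    rw [symForm_toIntVec_right] at hα
    simp at hα
  obtain ⟨i, hi, hpos⟩ := exists_symForm_simpleRoot_pos h0
  refine ⟨i, or_iff_not_imp_left.2 fun hne => ?_⟩
  have h1 : symForm (toIntVec α) (simpleRoot i) = 1 := by
    refine le_antisymm (symForm_simpleRoot_le_one hα fun h => hne (toIntVec_injective ?_)) hpos
    rw [h, toIntVec_single]
  have h2 : Finsupp.single i 1 ≤ α := by simpa using Nat.succ_le_of_lt hi
  have h3 : α = (α - Finsupp.single i 1) + Finsupp.single i 1 := (tsub_add_cancel_of_le h2).symm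
  -- Since (α, ε_i) = 1, this vector is s_i(α); it stays in `ℕ^I` because α_i > 0.
  refine ⟨α - Finsupp.single i 1, h3, ?_⟩
  have h4 : toIntVec (α - Finsupp.single i 1) = toIntVec α - simpleRoot i := by
    rw [eq_sub_iff_add_eq, ← toIntVec_single, ← toIntVec_add, ← h3]
  rw [h4, ← symFormBilin_apply, ← symFormBilin_apply]
  simp only [map_sub, LinearMap.sub_apply, symFormBilin_apply, hα, symForm_simpleRoot_self,
    symForm_comm (simpleRoot i) (toIntVec α), h1]
  simp

/-- The simple reflection as a linear automorphism. -/
def simpleReflectionEquiv (i : I) : (I →₀ ℤ) ≃ₗ[ℤ] (I →₀ ℤ) :=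
  Module.reflection (f := symFormBilin.flip (simpleRoot i)) (symForm_simpleRoot_self i)

lemma simpleReflectionEquiv_apply (i : I) (α : I →₀ ℤ) :
    simpleReflectionEquiv i α = simpleReflection i α :=
  Module.reflection_apply _ _

lemma simpleReflectionEquiv_mem (i : I) : simpleReflectionEquiv i ∈ weylGroup I :=
  Subgroup.subset_closure ⟨i, simpleReflectionEquiv_apply i⟩

lemma symForm_self_of_mem_weylGroup {s : (I →₀ ℤ) ≃ₗ[ℤ] (I →₀ ℤ)} (hs : s ∈ weylGroup I)
    (α : I →₀ ℤ) : symForm (s α) (s α) = symForm α α := by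
  induction hs using Subgroup.closure_induction generalizing α with
  | mem s h =>
    obtain ⟨i, hi⟩ := h
    rw [hi, simpleReflection, ← symFormBilin_apply]
    simp only [map_sub, map_smul, LinearMap.sub_apply, LinearMap.smul_apply, symFormBilin_apply,
      symForm_simpleRoot_self, symForm_comm (simpleRoot i) α, smul_eq_mul]
    ring
  | one => rfl
  | mul s t _ _ hs ht => rw [LinearEquiv.mul_apply, hs, ht]
  | inv s _ hs =>
    rw [← hs]
    change symForm (s (s.symm α)) (s (s.symm α)) = _
    rw [LinearEquiv.apply_symm_apply]

/-- A nonzero nonnegative vector always pairs positively with some simple root, so a definite quiver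
has no imaginary roots. -/
lemma fundamentalRegion_eq_empty : fundamentalRegion I = ∅ := by
  rw [Set.eq_empty_iff_forall_notMem]
  rintro β ⟨h0, hne, -, hβ⟩
  obtain ⟨α, rfl⟩ : ∃ α : I →₀ ℕ, toIntVec α = β :=
    ⟨β.mapRange Int.toNat rfl, by ext i; simp [h0]⟩
  obtain ⟨i, -, hi⟩ := exists_symForm_simpleRoot_pos (α := α) (by rintro rfl; simp at hne)
  exact (hβ i).not_gt hi

lemma IsRoot.symForm_self {α : I →₀ ℤ} (h : IsRoot α) : symForm α α = 2 := by
  rcases h with ⟨s, hs, i, rfl⟩ | ⟨s, hs, β, hβ, h⟩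
  · rw [symForm_self_of_mem_weylGroup hs, symForm_simpleRoot_self]
  · simp [fundamentalRegion_eq_empty] at hβ

/-- Simple reflections lower the height one step at a time, within `ℕ^I`, until a simple root is
reached. -/
lemma isRealRoot_toIntVec {α : I →₀ ℕ} (h : symForm (toIntVec α) (toIntVec α) = 2) :
    IsRealRoot (toIntVec α) := by
  induction hn : α.sum (fun _ n => n) using Nat.strong_induction_on generalizing α with
  | _ n ih =>
    obtain ⟨i, rfl | ⟨β, rfl, hβ, hi⟩⟩ := exists_add_single h
    · exact ⟨1, one_mem _, i, toIntVec_single i⟩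
    · obtain ⟨s, hs, j, hj⟩ := ih (β.sum fun _ n => n) (by
        rw [← hn, Finsupp.sum_add_index' (by simp) (by simp), Finsupp.sum_single_index rfl]
        exact Nat.lt_succ_self _) hβ rfl
      refine ⟨simpleReflectionEquiv i * s, mul_mem (simpleReflectionEquiv_mem i) hs, j, ?_⟩
      rw [LinearEquiv.mul_apply, ← hj, simpleReflectionEquiv_apply, simpleReflection, hi,
        toIntVec_add, toIntVec_single]
      simp

/-- This replaces Weyl orbits by a quadratic equation; from here on the Weyl group plays no part. -/
theorem isPositiveRoot_iff {α : I →₀ ℕ} :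
    IsPositiveRoot α ↔ symForm (toIntVec α) (toIntVec α) = 2 :=
  ⟨fun h => IsRoot.symForm_self h, fun h => Or.inl (isRealRoot_toIntVec h)⟩

lemma IsPositiveRoot.pFun_eq_zero {α : I →₀ ℕ} (h : IsPositiveRoot α) : pFun α = 0 := by
  rw [isPositiveRoot_iff, InfQuiver.symForm_self] at h
  rw [pFun_eq]
  lia

lemma IsPositiveRoot.ne_zero {α : I →₀ ℕ} (h : IsPositiveRoot α) : α ≠ 0 := by
  rintro rfl
  rw [isPositiveRoot_iff, symForm_toIntVec_right] at h
  simp at h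

/-- A disconnected support would split the root into two nonzero orthogonal parts, each of square
length at least 2, so the total would be at least 4. -/
lemma IsPositiveRoot.connectedOn_support {α : I →₀ ℕ} (h : IsPositiveRoot α) :
    ConnectedOn (α.support : Set I) := by
  classical
  obtain ⟨x, hx⟩ := Finsupp.support_nonempty_iff.2 h.ne_zero
  rw [ConnectedOn, SimpleGraph.connected_iff_exists_forall_reachable]
  refine ⟨⟨x, hx⟩, ?_⟩
  by_contra! hy
  obtain ⟨y, hy⟩ := hy
  set H := (SimpleGraph.fromRel fun i j : I => Nonempty (i ⟶ j)).induce (α.support : Set I)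
  let S : I → Prop := fun i => ∃ hi : i ∈ (α.support : Set I), H.Reachable ⟨x, hx⟩ ⟨i, hi⟩
  -- The part of α on the component of x, and below the part on the rest, which contains y.
  set β := α.filter S with hβ
  set γ := α.filter (fun i => ¬ S i) with hγ
  have hsum : toIntVec α = toIntVec β + toIntVec γ := by
    rw [← toIntVec_add, hβ, hγ, Finsupp.filter_add_filter_not]
  have hβ0 : toIntVec β ≠ 0 := by
    intro h
    have := DFunLike.congr_fun h x
    rw [toIntVec_apply, hβ, Finsupp.filter_apply_pos _ _ ⟨hx, SimpleGraph.Reachable.refl _⟩] at this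
    exact Finsupp.mem_support_iff.1 hx (by simpa using this)
  have hγ0 : toIntVec γ ≠ 0 := by
    intro h
    have := DFunLike.congr_fun h y.1
    rw [toIntVec_apply, hγ, Finsupp.filter_apply_pos _ _ (fun h => hy h.2)] at this
    exact Finsupp.mem_support_iff.1 y.2 (by simpa using this)
  have horth : symForm (toIntVec β) (toIntVec γ) = 0 := by
    have h1 : ∀ i, i ∉ α.support → α i = 0 := fun i => Finsupp.notMem_support_iff.1
    rw [symForm_eq α.support (by rw [support_toIntVec, hβ, Finsupp.support_filter]; simp)
      (by rw [support_toIntVec, hγ, Finsupp.support_filter]; simp)]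
    rw [Finset.sum_eq_zero, Finset.sum_eq_zero]
    · simp
    · intro a ha
      by_contra h2
      simp only [toIntVec_apply, mul_eq_zero, not_or, Nat.cast_eq_zero, hβ, hγ,
        Finsupp.filter_apply, ite_eq_right_iff, Classical.not_imp] at h2
      obtain ⟨⟨⟨ht, hr⟩, -⟩, hS, -⟩ := h2
      have hh := (mem_arrowsIn.1 ha).1
      refine hS ⟨hh, hr.trans (SimpleGraph.Adj.reachable ?_)⟩
      simp only [H, SimpleGraph.comap_adj, SimpleGraph.fromRel_adj, Function.Embedding.subtype_apply]
      refine ⟨tail_ne_head a, ?_⟩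
      rcases a with ⟨i, j, a | a⟩
      · exact Or.inl ⟨a⟩
      · exact Or.inr ⟨a⟩
    · intro i _
      simp only [toIntVec_apply, hβ, hγ, Finsupp.filter_apply]
      split_ifs <;> simp
  have h1 := two_le_symForm_self hβ0
  have h2 := two_le_symForm_self hγ0
  rw [isPositiveRoot_iff, hsum, ← symFormBilin_apply] at h
  simp only [map_add, LinearMap.add_apply, symFormBilin_apply, horth,
    symForm_comm (toIntVec γ) (toIntVec β)] at h
  lia

end DefiniteForm

/-! ### Roots of full subquivers -/

section FullSubquivers

variable {I : Type u}

lemma FullSubquiver.incl_injective (J : Set I) :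
    Function.Injective (FullSubquiver.incl (J := J)) :=
  fun _ _ h => FullSubquiver.ext h

lemma mapDomain_incl_eq_zero {J : Set I} {A : Type*} [AddCommMonoid A] (γ : FullSubquiver J →₀ A)
    {i : I} (hi : i ∉ J) : γ.mapDomain FullSubquiver.incl i = 0 :=
  Finsupp.mapDomain_of_notMem_range _ _ fun ⟨j, hj⟩ => hi (hj ▸ j.mem)

lemma pairing_mapDomain {J : Set I} (lam : I → ℂ) (γ : FullSubquiver J →₀ ℕ) :
    pairing lam (γ.mapDomain FullSubquiver.incl) =
      pairing (fun j : FullSubquiver J => lam j.incl) γ :=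
  Finsupp.sum_mapDomain_index_inj (FullSubquiver.incl_injective J)

variable [Quiver.{v} I]

/-- The arrows of a full subquiver as arrows of the quiver. -/
def FullSubquiver.mapArrow {J : Set I} (a : Quiver.Total (FullSubquiver J)) : Quiver.Total I :=
  ⟨a.left.incl, a.right.incl, a.hom⟩

lemma FullSubquiver.mapArrow_injective (J : Set I) :
    Function.Injective (FullSubquiver.mapArrow (J := J)) := by
  rintro ⟨⟨i, hi⟩, ⟨j, hj⟩, a⟩ ⟨⟨k, hk⟩, ⟨l, hl⟩, b⟩ h
  simp only [mapArrow, Quiver.Total.mk.injEq] at h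
  obtain ⟨rfl, rfl, h⟩ := h
  obtain rfl := eq_of_heq h
  rfl

/-- An arrow contributes only if both of its ends lie in J, and all such arrows belong to the full
subquiver. -/
lemma ringelForm_mapDomain {J : Set I} (γ γ' : FullSubquiver J →₀ ℤ) :
    ringelForm (γ.mapDomain FullSubquiver.incl) (γ'.mapDomain FullSubquiver.incl) =
      ringelForm γ γ' := by
  have hinj := FullSubquiver.incl_injective J
  rw [ringelForm, ringelForm, Finsupp.sum_mapDomain_index_inj hinj]
  simp only [Finsupp.mapDomain_apply hinj]
  congr 1
  rw [← finsum_mem_univ, finsum_mem_inter_support_eq _ _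
    (Set.range (FullSubquiver.mapArrow (J := J))), finsum_mem_range
    (FullSubquiver.mapArrow_injective J)]
  · simp [FullSubquiver.mapArrow, Finsupp.mapDomain_apply hinj]
  · ext ⟨i, j, a⟩
    simp only [Set.univ_inter, Set.mem_inter_iff, iff_and_self, Function.mem_support]
    intro h
    have hi : i ∈ J := by
      by_contra hi
      exact h (by rw [mapDomain_incl_eq_zero _ hi, zero_mul])
    have hj : j ∈ J := by
      by_contra hj
      exact h (by rw [mapDomain_incl_eq_zero γ' hj, mul_zero])
    exact ⟨⟨⟨i, hi⟩, ⟨j, hj⟩, a⟩, rfl⟩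

instance [LocallyFiniteQuiver I] (J : Set I) : LocallyFiniteQuiver (FullSubquiver J) where
  finite_head_eq i := by
    refine Set.Finite.of_finite_image ((LocallyFiniteQuiver.finite_head_eq i.incl).subset ?_)
      (f := fun a : DoubleArrow (FullSubquiver J) =>
        (⟨a.left.incl, a.right.incl, a.hom⟩ : DoubleArrow I)) ?_
    · rintro _ ⟨a, rfl, rfl⟩
      rfl
    · rintro ⟨⟨i, hi⟩, ⟨j, hj⟩, a⟩ _ ⟨⟨k, hk⟩, ⟨l, hl⟩, b⟩ _ h
      obtain ⟨rfl, rfl, h⟩ := h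
      rfl

instance [DefiniteQuiver I] (J : Set I) : DefiniteQuiver (FullSubquiver J) where
  ringelForm_pos γ hγ := by
    rw [← ringelForm_mapDomain]
    refine DefiniteQuiver.ringelForm_pos _ fun h => hγ ?_
    exact Finsupp.mapDomain_injective (FullSubquiver.incl_injective J) (by simpa using h)

lemma toIntVec_mapDomain {J : Set I} (γ : FullSubquiver J →₀ ℕ) :
    toIntVec (γ.mapDomain FullSubquiver.incl) = (toIntVec γ).mapDomain FullSubquiver.incl := by
  ext i
  rw [toIntVec_apply]
  by_cases hi : i ∈ J
  · have := FullSubquiver.incl_injective J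
    change ((γ.mapDomain FullSubquiver.incl (FullSubquiver.incl ⟨i, hi⟩) : ℕ) : ℤ) =
      (toIntVec γ).mapDomain FullSubquiver.incl (FullSubquiver.incl ⟨i, hi⟩)
    rw [Finsupp.mapDomain_apply this, Finsupp.mapDomain_apply this, toIntVec_apply]
  · rw [mapDomain_incl_eq_zero _ hi, mapDomain_incl_eq_zero _ hi, Nat.cast_zero]

variable [LocallyFiniteQuiver I] [DefiniteQuiver I]

/-- Being a positive root depends only on the square length, so the two Weyl groups need not be
compared. -/
lemma isPositiveRoot_mapDomain {J : Set I} {γ : FullSubquiver J →₀ ℕ} :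
    IsPositiveRoot (γ.mapDomain FullSubquiver.incl) ↔ IsPositiveRoot γ := by
  rw [isPositiveRoot_iff, isPositiveRoot_iff, toIntVec_mapDomain, symForm, symForm,
    ringelForm_mapDomain]

/-- For the converse the subquiver is the support of the root, which is finite and connected. -/
theorem isFiniteTypeRoot_iff {lam : I → ℂ} {α : I →₀ ℕ} :
    IsFiniteTypeRoot lam α ↔ IsPositiveRoot α ∧ pairing lam α = 0 := by
  constructor
  · rintro ⟨J, -, -, γ, hγ, rfl, h⟩
    exact ⟨isPositiveRoot_mapDomain.2 hγ, (pairing_mapDomain lam γ).trans h⟩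
  · rintro ⟨h, h'⟩
    have hinj := FullSubquiver.incl_injective (α.support : Set I)
    have hα : (α.comapDomain FullSubquiver.incl hinj.injOn).mapDomain FullSubquiver.incl = α :=
      Finsupp.mapDomain_comapDomain _ hinj _ fun i hi => ⟨⟨i, hi⟩, rfl⟩
    refine ⟨α.support, α.support.finite_toSet, h.connectedOn_support,
      α.comapDomain FullSubquiver.incl hinj.injOn, ?_, hα, ?_⟩
    · rwa [← isPositiveRoot_mapDomain, hα]
    · rwa [← pairing_mapDomain, hα]

end FullSubquivers

/-! ### Positive definiteness for the infinite affine graphs -/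

section InfiniteAffine

/-- Twice the form is the sum of the squares of y_k - y_{k+1}. If it vanished, y would be constant,
which finite support allows only for y = 0. -/
lemma sum_line_pos {y : ℤ →₀ ℤ} (hy : y ≠ 0) :
    0 < (∑ᶠ k, y k * y k) - ∑ᶠ k, y k * y (k + 1) := by
  have hf : ∀ g : ℤ → ℤ, (fun k => y k * g k).HasFiniteSupport := fun g =>
    y.hasFiniteSupport.subset fun k hk => left_ne_zero_of_mul hk
  have hshift : ∑ᶠ k, y (k + 1) * y (k + 1) = ∑ᶠ k, y k * y k :=
    finsum_comp_equiv (Equiv.addRight (1 : ℤ)) (f := fun k => y k * y k)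
  have hf' : (fun k => y (k + 1) * y (k + 1)).HasFiniteSupport :=
    (hf y).preimage (Equiv.addRight (1 : ℤ)).injective.injOn
  have key : ∑ᶠ k, (y k - y (k + 1)) ^ 2 =
      2 * ((∑ᶠ k, y k * y k) - ∑ᶠ k, y k * y (k + 1)) := by
    have : ∀ k, (y k - y (k + 1)) ^ 2 =
        y k * (y k - 2 * y (k + 1)) + y (k + 1) * y (k + 1) := fun k => by ring
    simp only [this]
    rw [finsum_add_distrib (hf _) hf', hshift]
    have : ∀ k, y k * (y k - 2 * y (k + 1)) = y k * y k - y k * (2 * y (k + 1)) :=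
      fun k => by ring
    simp only [this]
    rw [finsum_sub_distrib (hf _) (hf _)]
    have : ∀ k, y k * (2 * y (k + 1)) = 2 * (y k * y (k + 1)) := fun k => by ring
    simp only [this]
    rw [← mul_finsum' _ _ (hf _)]
    ring
  by_contra! h
  have hfin : (fun k => (y k - y (k + 1)) ^ 2).HasFiniteSupport := by
    refine ((hf y).union hf').subset fun k hk => ?_
    by_contra h'
    simp_all
  have hz : ∀ k, y k = y (k + 1) := by
    intro k
    have h1 : (y k - y (k + 1)) ^ 2 ≤ ∑ᶠ k, (y k - y (k + 1)) ^ 2 :=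
      single_le_finsum k hfin fun _ => sq_nonneg _
    have h2 : (y k - y (k + 1)) ^ 2 = 0 := le_antisymm (by lia) (sq_nonneg _)
    exact sub_eq_zero.1 (pow_eq_zero_iff two_ne_zero |>.1 h2)
  obtain ⟨k, hk⟩ := Finsupp.ne_iff.1 hy
  have hn : ∀ n : ℕ, y (k + n) = y k := by
    intro n
    induction n with
    | zero => simp
    | succ n ih => rw [← ih, hz (k + n)]; push_cast; rw [add_assoc]
  -- The nonzero value at k propagates to all k + n, making the support infinite.
  refine Set.infinite_of_injective_forall_mem (f := fun n : ℕ => k + n) (fun m n h => by simpa using h)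
    (fun n => ?_) y.hasFiniteSupport
  simpa [hn n] using hk

lemma exists_eq_zero_of_le (y : ℕ →₀ ℤ) : ∃ n, ∀ k, n ≤ k → y k = 0 := by
  obtain ⟨n, hn⟩ := y.support.exists_nat_subset_range
  refine ⟨n, fun k hk => Finsupp.notMem_support_iff.1 fun h => ?_⟩
  exact hk.not_gt (Finset.mem_range.1 (hn h))

lemma finsum_eq_sum_range {y : ℕ →₀ ℤ} {n : ℕ} (hn : ∀ k, n ≤ k → y k = 0) (g : ℕ → ℤ) :
    ∑ᶠ k, y k * g k = ∑ k ∈ Finset.range n, y k * g k := by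
  refine finsum_eq_sum_of_support_subset _ fun k hk => ?_
  by_contra h
  exact left_ne_zero_of_mul hk (hn k (by simpa using h))

lemma sum_halfLine_pos {y : ℕ →₀ ℤ} (hy : y ≠ 0) :
    0 < (∑ᶠ k, y k * y k) - ∑ᶠ k, y k * y (k + 1) := by
  obtain ⟨n, hn⟩ := exists_eq_zero_of_le y
  rw [finsum_eq_sum_range hn, finsum_eq_sum_range hn, ← Finset.sum_sub_distrib]
  -- The square of y_0 survives the telescoping at the end of the half line; that of y_n vanishes
  -- beyond the support.
  have key : ∀ n, 2 * ∑ k ∈ Finset.range n, (y k * y k - y k * y (k + 1)) =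
      y 0 ^ 2 - y n ^ 2 + ∑ k ∈ Finset.range n, (y k - y (k + 1)) ^ 2 := by
    intro n
    induction n with
    | zero => simp
    | succ n ih => rw [Finset.sum_range_succ, Finset.sum_range_succ, mul_add, ih]; ring
  by_contra! h
  have h1 := key n
  have h2 : 0 ≤ ∑ k ∈ Finset.range n, (y k - y (k + 1)) ^ 2 :=
    Finset.sum_nonneg fun _ _ => sq_nonneg _
  have h3 := sq_nonneg (y 0)
  rw [hn n le_rfl] at h1
  have h4 : y 0 = 0 := pow_eq_zero_iff two_ne_zero |>.1 (by lia : y 0 ^ 2 = 0)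
  have h5 : ∑ k ∈ Finset.range n, (y k - y (k + 1)) ^ 2 = 0 := by lia
  rw [Finset.sum_eq_zero_iff_of_nonneg fun _ _ => sq_nonneg _] at h5
  refine hy (Finsupp.ext fun k => ?_)
  induction k with
  | zero => exact h4
  | succ k ih =>
    rcases lt_or_ge k n with hk | hk
    · have := pow_eq_zero_iff two_ne_zero |>.1 (h5 k (Finset.mem_range.2 hk))
      simp only [Finsupp.coe_zero, Pi.zero_apply] at *
      lia
    · exact hn _ (by lia)

/-- The larger end of the edges of the graph `D_∞`. -/
def dNext (k : ℕ) : ℕ := if k = 0 then 2 else k + 1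

lemma sum_dInf_pos {y : ℕ →₀ ℤ} (hy : y ≠ 0) :
    0 < (∑ᶠ k, y k * y k) - ∑ᶠ k, y k * y (dNext k) := by
  obtain ⟨n, hn⟩ := exists_eq_zero_of_le y
  have hn' : ∀ k, n + 2 ≤ k → y k = 0 := fun k hk => hn k (by lia)
  rw [finsum_eq_sum_range hn', finsum_eq_sum_range hn', ← Finset.sum_sub_distrib]
  -- The terms k = 0, 1 are the tips of the fork at 2. They give the first two squares minus the
  -- square of y_2, with which the telescoping sum along the half line starts.
  have key : ∀ n, 2 * ∑ k ∈ Finset.range (n + 2), (y k * y k - y k * y (dNext k)) =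
      (y 0 + y 1 - y 2) ^ 2 + (y 0 - y 1) ^ 2 - y (n + 2) ^ 2 +
        ∑ k ∈ Finset.range n, (y (k + 2) - y (k + 3)) ^ 2 := by
    intro n
    induction n with
    | zero => simp [Finset.sum_range_succ, dNext]; ring
    | succ n ih =>
      rw [Finset.sum_range_succ, Finset.sum_range_succ _ n, mul_add, ih]
      simp only [dNext, Nat.add_eq_zero_iff, OfNat.ofNat_ne_zero, and_false, if_false]
      ring_nf
  by_contra! h
  have h1 := key n
  have h2 : 0 ≤ ∑ k ∈ Finset.range n, (y (k + 2) - y (k + 3)) ^ 2 :=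
    Finset.sum_nonneg fun _ _ => sq_nonneg _
  have h3 := sq_nonneg (y 0 + y 1 - y 2)
  have h3' := sq_nonneg (y 0 - y 1)
  rw [hn' (n + 2) le_rfl] at h1
  have h4 := pow_eq_zero_iff two_ne_zero |>.1 (by linarith : (y 0 + y 1 - y 2) ^ 2 = 0)
  have h4' := pow_eq_zero_iff two_ne_zero |>.1 (by linarith : (y 0 - y 1) ^ 2 = 0)
  have h5 : ∑ k ∈ Finset.range n, (y (k + 2) - y (k + 3)) ^ 2 = 0 := by lia
  rw [Finset.sum_eq_zero_iff_of_nonneg fun _ _ => sq_nonneg _] at h5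
  have h6 : ∀ k, k ≤ n → y (k + 2) = y 2 := by
    intro k
    induction k with
    | zero => simp
    | succ k ih =>
      intro hk
      have := pow_eq_zero_iff two_ne_zero |>.1 (h5 k (Finset.mem_range.2 hk))
      rw [← ih (by lia), show k + 1 + 2 = k + 3 by rfl]
      lia
  have h7 : y 2 = 0 := by rw [← h6 n le_rfl]; exact hn' _ le_rfl
  refine hy (Finsupp.ext fun k => ?_)
  simp only [Finsupp.coe_zero, Pi.zero_apply]
  match k with
  | 0 => lia
  | 1 => lia
  | k + 2 =>
    rcases le_or_gt k n with hk | hk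
    · rw [h6 k hk, h7]
    · exact hn _ (by lia)

variable {I : Type u} [Quiver.{v} I]

namespace IsOrientationOf

variable {G : SimpleGraph I} (hG : IsOrientationOf I G)

include hG

lemma adj (a : Quiver.Total I) : G.Adj a.left a.right := by
  by_contra h
  exact (hG.of_not_adj _ _ h).false (Sum.inl a.hom)

/-- An edge carries exactly one arrow in exactly one direction, so an arrow is determined by its
unordered pair of ends. -/
lemma total_eq {a b : Quiver.Total I}
    (h : (a.left = b.left ∧ a.right = b.right) ∨ (a.left = b.right ∧ a.right = b.left)) :
    a = b := by
  have hadj := hG.adj a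
  rcases a with ⟨i, j, a⟩
  rcases b with ⟨k, l, b⟩
  obtain ⟨hu⟩ := hG.of_adj _ _ hadj
  rcases h with ⟨h1, h2⟩ | ⟨h1, h2⟩
  · obtain rfl : i = k := h1
    obtain rfl : j = l := h2
    have : (Sum.inl a : (i ⟶ j) ⊕ (j ⟶ i)) = Sum.inl b := Subsingleton.elim _ _
    rw [Sum.inl.inj this]
  · obtain rfl : i = l := h1
    obtain rfl : j = k := h2
    have : (Sum.inl a : (i ⟶ j) ⊕ (j ⟶ i)) = Sum.inr b := Subsingleton.elim _ _
    simp at this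

variable {V : Type*} (e : I ≃ V) (t : V → V)
  (hadj : ∀ i j, G.Adj i j ↔ (e j = t (e i) ∨ e i = t (e j)))

include hadj

lemma locallyFiniteQuiver (hfin : ∀ k, {l | t l = k}.Finite) : LocallyFiniteQuiver I where
  finite_head_eq i := by
    refine Set.Finite.of_finite_image (f := tail)
      (((hfin (e i)).insert (t (e i))).preimage e.injective.injOn |>.subset ?_) ?_
    · rintro _ ⟨⟨j, i, a⟩, rfl, rfl⟩
      have : G.Adj i j := by
        by_contra h
        exact (hG.of_not_adj _ _ h).false (Sum.swap a)
      exact ((hadj i j).1 this).imp id Eq.symm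
    · rintro ⟨j, i, a⟩ rfl ⟨k, l, b⟩ h1 h2
      obtain rfl : j = k := h2
      obtain rfl : l = i := h1
      have : G.Adj j l := by
        by_contra h
        exact (hG.of_not_adj _ _ h).false a
      obtain ⟨hu⟩ := hG.of_adj _ _ this
      have : a = b := hu.instSubsingleton.elim a b
      rw [this]

/-- The map t sends a vertex to the far end of the edge attached to it, so that the edges {k, t k}
are indexed by the vertices. The form does not see the orientation, since each arrow contributes a
symmetric product. -/
lemma definiteQuiver (ht : ∀ k, t (t k) ≠ k)
    (hpos : ∀ y : V →₀ ℤ, y ≠ 0 → 0 < (∑ᶠ k, y k * y k) - ∑ᶠ k, y k * y (t k)) :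
    DefiniteQuiver I where
  ringelForm_pos α hα := by
    have h0 : α.equivMapDomain e ≠ 0 := by
      contrapose! hα
      ext i
      simpa using DFunLike.congr_fun hα (e i)
    convert hpos _ h0 using 1
    simp only [Finsupp.equivMapDomain_apply]
    rw [ringelForm]
    congr 1
    · rw [finsum_comp_equiv e.symm (f := fun i => α i * α i)]
      refine (finsum_eq_sum_of_support_subset _ fun k hk => ?_).symm
      exact Finsupp.mem_support_iff.2 (left_ne_zero_of_mul hk)
    · have hex : ∀ k, ∃ a : Quiver.Total I, (a.left = e.symm k ∧ a.right = e.symm (t k)) ∨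
          (a.left = e.symm (t k) ∧ a.right = e.symm k) := by
        intro k
        obtain ⟨hu⟩ := hG.of_adj (e.symm k) (e.symm (t k)) ((hadj _ _).2 (by simp))
        rcases hu.default with a | a
        · exact ⟨⟨_, _, a⟩, Or.inl ⟨rfl, rfl⟩⟩
        · exact ⟨⟨_, _, a⟩, Or.inr ⟨rfl, rfl⟩⟩
      choose φ hφ using hex
      -- If distinct k and l gave the same edge, then k = t l and l = t k, which `ht` excludes.
      refine (finsum_eq_of_bijective φ ⟨fun k l h => ?_, fun a => ?_⟩ fun k => ?_).symm
      · have hk := hφ k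
        have hl := hφ l
        rw [h] at hk
        have := ht k
        have := ht l
        rcases hk with ⟨h1, h2⟩ | ⟨h1, h2⟩ <;> rcases hl with ⟨h3, h4⟩ | ⟨h3, h4⟩ <;>
          simp only [h3, h4, EmbeddingLike.apply_eq_iff_eq] at h1 h2 <;> grind
      · rcases (hadj _ _).1 (hG.adj a) with h | h
        · refine ⟨e a.left, hG.total_eq ?_⟩
          simpa [← h] using hφ (e a.left)
        · refine ⟨e a.right, hG.total_eq ?_⟩
          simpa [← h, or_comm] using hφ (e a.right)
      · rcases hφ k with ⟨h1, h2⟩ | ⟨h1, h2⟩ <;> simp [h1, h2, mul_comm]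

end IsOrientationOf

theorem IsInfiniteAffine.locallyFinite_and_definite (h : IsInfiniteAffine I) :
    LocallyFiniteQuiver I ∧ DefiniteQuiver I := by
  obtain ⟨G, hG, ⟨⟨e⟩⟩ | ⟨⟨e⟩⟩ | ⟨⟨e⟩⟩⟩ := h
  · have hadj : ∀ i j, G.Adj i j ↔ (e j = e i + 1 ∨ e i = e j + 1) := by
      intro i j
      rw [← e.map_adj_iff]
      exact (SimpleGraph.fromRel_adj _ _ _).trans (by lia)
    refine ⟨hG.locallyFiniteQuiver e.toEquiv (· + 1) hadj fun k => ?_,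
      hG.definiteQuiver e.toEquiv (· + 1) hadj (fun k => by lia) fun y => sum_line_pos⟩
    exact (Set.finite_singleton (k - 1)).subset fun l hl => by
      simp only [Set.mem_ofPred_eq, Set.mem_singleton_iff] at *
      lia
  · have hadj : ∀ i j, G.Adj i j ↔ (e j = e i + 1 ∨ e i = e j + 1) := by
      intro i j
      rw [← e.map_adj_iff]
      exact (SimpleGraph.fromRel_adj _ _ _).trans (by lia)
    refine ⟨hG.locallyFiniteQuiver e.toEquiv (· + 1) hadj fun k => ?_,
      hG.definiteQuiver e.toEquiv (· + 1) hadj (fun k => by lia) fun y => sum_halfLine_pos⟩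
    exact (Set.finite_Iic k).subset fun l hl => by
      simp only [Set.mem_ofPred_eq, Set.mem_Iic] at *
      lia
  · have hadj : ∀ i j, G.Adj i j ↔ (e j = dNext (e i) ∨ e i = dNext (e j)) := by
      intro i j
      rw [← e.map_adj_iff, dNext, dNext]
      exact (SimpleGraph.fromRel_adj _ _ _).trans (by split_ifs <;> lia)
    refine ⟨hG.locallyFiniteQuiver e.toEquiv dNext hadj fun k => ?_,
      hG.definiteQuiver e.toEquiv dNext hadj (fun k => by unfold dNext; split_ifs <;> lia)
        fun y => sum_dInf_pos⟩
    exact (Set.finite_Iic k).subset fun l hl => by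
      simp only [Set.mem_ofPred_eq, Set.mem_Iic, dNext] at *
      split_ifs at hl <;> lia

end InfiniteAffine

/-! ### Calculus in the completed path algebra -/

section PathAlgebra

variable {I : Type u} [Quiver.{v} I]

/-- The canonical map from `B × E` to the tensor algebra `T_B E`. -/
def generator : VertexAlgebra I × ArrowSpace I →ₗ[ℂ] CompletedPathAlgebra I :=
  (RingQuot.mkAlgHom ℂ TensorRel).toLinearMap ∘ₗ TensorAlgebra.ι ℂ

lemma generator_left (b : VertexAlgebra I) : generator (b, 0) = ofVertex b := rfl

lemma generator_right (x : ArrowSpace I) : generator ((0 : VertexAlgebra I), x) = ofArrow x := rfl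

lemma ofVertex_mul (b c : VertexAlgebra I) : ofVertex (b * c) = ofVertex b * ofVertex c := by
  rw [ofVertex, RingQuot.mkAlgHom_rel ℂ (TensorRel.mul b c), map_mul]
  rfl

lemma ofArrow_lact (b : VertexAlgebra I) (x : ArrowSpace I) :
    ofArrow (lact b x) = ofVertex b * ofArrow x := by
  rw [ofArrow, RingQuot.mkAlgHom_rel ℂ (TensorRel.left b x), map_mul]
  rfl

lemma ofArrow_ract (x : ArrowSpace I) (b : VertexAlgebra I) :
    ofArrow (ract x b) = ofArrow x * ofVertex b := by
  rw [ofArrow, RingQuot.mkAlgHom_rel ℂ (TensorRel.right x b), map_mul]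
  rfl

lemma ofVertex_sum {ι : Type*} (s : Finset ι) (c : ι → ℂ) (b : ι → VertexAlgebra I) :
    ofVertex (∑ k ∈ s, c k • b k) = ∑ k ∈ s, c k • ofVertex (b k) := by
  simp only [← generator_left, ← map_smul, ← map_sum]
  congr 1
  ext <;> simp [Prod.fst_sum, Prod.snd_sum]

lemma ofArrow_sum {ι : Type*} (s : Finset ι) (c : ι → ℂ) (x : ι → ArrowSpace I) :
    ofArrow (∑ k ∈ s, c k • x k) = ∑ k ∈ s, c k • ofArrow (x k) := by
  simp only [← generator_right, ← map_smul, ← map_sum]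
  congr 1
  ext <;> simp [Prod.fst_sum, Prod.snd_sum]

lemma idem_mul_self (i : I) : idem i * idem i = idem i := by
  rw [idem, ← ofVertex_mul]
  congr 1
  ext j
  by_cases h : j = i
  · subst h; simp
  · simp [h]

lemma idem_mul_of_ne {i j : I} (h : i ≠ j) : idem i * idem j = 0 := by
  rw [idem, idem, ← ofVertex_mul, ← generator_left, ← map_zero generator]
  congr 2
  ext k
  by_cases hk : k = i
  · subst hk; simp [h]
  · simp [hk]

lemma idem_head_mul_arrowElem (a : DoubleArrow I) :
    idem (head a) * arrowElem a = arrowElem a := by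
  rw [idem, arrowElem, ← ofArrow_lact]
  congr 1
  ext b
  by_cases h : b = a
  · subst h; simp [lact]
  · simp [lact, h]

lemma arrowElem_mul_idem_tail (a : DoubleArrow I) :
    arrowElem a * idem (tail a) = arrowElem a := by
  rw [idem, arrowElem, ← ofArrow_ract]
  congr 1
  ext b
  by_cases h : b = a
  · subst h; simp [ract]
  · simp [ract, h]

lemma completedPathAlgebra_induction {p : CompletedPathAlgebra I → Prop}
    (vertex : ∀ b, p (ofVertex b)) (arrow : ∀ x, p (ofArrow x))
    (scalar : ∀ c, p (algebraMap ℂ _ c)) (add : ∀ x y, p x → p y → p (x + y))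
    (mul : ∀ x y, p x → p y → p (x * y)) (x : CompletedPathAlgebra I) : p x := by
  obtain ⟨x, rfl⟩ := RingQuot.mkAlgHom_surjective ℂ TensorRel x
  induction x using TensorAlgebra.induction with
  | algebraMap r => rw [AlgHom.commutes]; exact scalar r
  | ι x =>
    have : TensorAlgebra.ι ℂ x = TensorAlgebra.ι ℂ (x.1, 0) + TensorAlgebra.ι ℂ (0, x.2) := by
      rw [← map_add]; simp
    rw [this, map_add]
    exact add _ _ (vertex _) (arrow _)
  | mul a b ha hb => rw [map_mul]; exact mul _ _ ha hb
  | add a b ha hb => rw [map_add]; exact add _ _ ha hb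

section

variable {A : Type*} [Ring A] [Algebra ℂ A] {s : Finset I} (φ : CompletedPathAlgebra I →ₐ[ℂ] A)
  (hφ : ∑ i ∈ s, φ (idem i) = 1)

include hφ

/-- With c the sum of the e_i for i in s, c acts as 1 and c b is a finite combination of
idempotents. So an infinite family acts through finitely many of its entries. -/
lemma map_ofVertex_eq_sum (b : VertexAlgebra I) :
    φ (ofVertex b) = ∑ i ∈ s, b i • φ (idem i) := by
  classical
  have h : ∑ i ∈ s, φ (idem i) = φ (ofVertex (∑ i ∈ s, (1 : ℂ) • Pi.single i 1)) := by
    rw [ofVertex_sum, map_sum]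
    simp only [one_smul]
    rfl
  rw [← one_mul (φ (ofVertex b)), ← hφ, h, ← map_mul, ← ofVertex_mul]
  have : (∑ i ∈ s, (1 : ℂ) • Pi.single i 1) * b = ∑ i ∈ s, b i • (Pi.single i 1 : I → ℂ) := by
    rw [Finset.sum_mul]
    refine Finset.sum_congr rfl fun i _ => ?_
    ext j
    by_cases h : j = i
    · subst h; simp
    · simp [h]
  rw [this, ofVertex_sum, map_sum]
  simp only [map_smul]
  rfl

lemma map_ofArrow_eq_sum [LocallyFiniteQuiver I] (x : ArrowSpace I) :
    φ (ofArrow x) = ∑ a ∈ arrowsIn s, x a • φ (arrowElem a) := by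
  classical
  set c : VertexAlgebra I := ∑ i ∈ s, (1 : ℂ) • Pi.single i 1 with hc
  have h : φ (ofVertex c) = 1 := by
    rw [hc, ofVertex_sum, map_sum, ← hφ]
    simp only [one_smul]
    rfl
  have hc' : ∀ i, c i = if i ∈ s then 1 else 0 := by
    intro i
    rw [hc, Finset.sum_apply]
    simp [Pi.single_apply]
  rw [← one_mul (φ (ofArrow x)), ← mul_one (1 * φ (ofArrow x)), ← h, ← map_mul, ← map_mul,
    ← ofArrow_lact, ← ofArrow_ract]
  have : ract (lact c x) c = ∑ a ∈ arrowsIn s, x a • (Pi.single a 1 : DoubleArrow I → ℂ) := by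
    ext b
    rw [Finset.sum_apply]
    simp only [ract, lact, hc', Pi.smul_apply, Pi.single_apply, smul_eq_mul, mul_ite, mul_one,
      mul_zero, Finset.sum_ite_eq, mem_arrowsIn]
    split_ifs <;> simp_all
  rw [this, ofArrow_sum, map_sum]
  simp only [map_smul]
  rfl

end

end PathAlgebra

/-! ### Representations as families of operators -/

section MomentReps

variable {I : Type u} [Quiver.{v} I] [LocallyFiniteQuiver I]

/-- Operators on a space `M`, which may be larger than `⨁ e_i M`, that satisfy the deformed
preprojective relations. -/
structure MomentOperators (lam : I → ℂ) (M : Type*) [AddCommGroup M] [Module ℂ M] where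
  e : I → Module.End ℂ M
  x : DoubleArrow I → Module.End ℂ M
  e_mul_self : ∀ i, e i * e i = e i
  e_mul_of_ne : ∀ i j, i ≠ j → e i * e j = 0
  e_head_mul : ∀ a, e (head a) * x a = x a
  mul_e_tail : ∀ a, x a * e (tail a) = x a
  moment : ∀ i, ∑ a ∈ inArrows i, arrowSign a • (x a * x (reverseArrow a)) = lam i • e i

/-- A representation of the double quiver on the space `M = ⨁ e_i M` with finite support that
satisfies the deformed preprojective relations. -/
structure MomentRep (lam : I → ℂ) (M : Type*) [AddCommGroup M] [Module ℂ M] extends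
    MomentOperators lam M where
  vertices : Finset I
  sum_e : ∑ i ∈ vertices, e i = 1

namespace MomentRep

variable {lam : I → ℂ} {M : Type*} [AddCommGroup M] [Module ℂ M] (ρ : MomentRep lam M)

lemma e_eq_zero {i : I} (hi : i ∉ ρ.vertices) : ρ.e i = 0 := by
  rw [← mul_one (ρ.e i), ← ρ.sum_e, Finset.mul_sum]
  exact Finset.sum_eq_zero fun j hj => ρ.e_mul_of_ne _ _ fun h => hi (h ▸ hj)

lemma sum_e_of_subset {s : Finset I} (hs : ρ.vertices ⊆ s) : ∑ i ∈ s, ρ.e i = 1 := by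
  rw [← ρ.sum_e]
  exact (Finset.sum_subset hs fun i _ hi => ρ.e_eq_zero hi).symm

lemma e_mul_of_ne_head {i : I} {a : DoubleArrow I} (h : i ≠ head a) : ρ.e i * ρ.x a = 0 := by
  rw [← ρ.e_head_mul, ← mul_assoc, ρ.e_mul_of_ne _ _ h, zero_mul]

lemma mul_e_of_ne_tail {i : I} {a : DoubleArrow I} (h : i ≠ tail a) : ρ.x a * ρ.e i = 0 := by
  rw [← ρ.mul_e_tail, mul_assoc, ρ.e_mul_of_ne _ _ h.symm, mul_zero]

lemma x_eq_zero_of_tail {a : DoubleArrow I} (h : tail a ∉ ρ.vertices) : ρ.x a = 0 := by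
  rw [← ρ.mul_e_tail, ρ.e_eq_zero h, mul_zero]

lemma x_eq_zero {a : DoubleArrow I} (h : a ∉ arrowsIn ρ.vertices) : ρ.x a = 0 := by
  rw [mem_arrowsIn, not_and_or] at h
  rcases h with h | h
  · rw [← ρ.e_head_mul, ρ.e_eq_zero h, zero_mul]
  · exact ρ.x_eq_zero_of_tail h

/-- The action of `B × E`. -/
def generatorAction : VertexAlgebra I × ArrowSpace I →ₗ[ℂ] Module.End ℂ M :=
  (∑ i ∈ ρ.vertices, (LinearMap.proj i ∘ₗ LinearMap.fst ℂ _ _).smulRight (ρ.e i)) +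
    ∑ a ∈ arrowsIn ρ.vertices, (LinearMap.proj a ∘ₗ LinearMap.snd ℂ _ _).smulRight (ρ.x a)

lemma generatorAction_left (b : VertexAlgebra I) :
    ρ.generatorAction (b, 0) = ∑ i ∈ ρ.vertices, b i • ρ.e i := by
  simp [generatorAction, LinearMap.sum_apply]

lemma generatorAction_right (y : ArrowSpace I) :
    ρ.generatorAction (0, y) = ∑ a ∈ arrowsIn ρ.vertices, y a • ρ.x a := by
  simp [generatorAction, LinearMap.sum_apply]

/-- The action of the completed path algebra. -/
def pathAction : CompletedPathAlgebra I →ₐ[ℂ] Module.End ℂ M :=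
  RingQuot.liftAlgHom ℂ ⟨TensorAlgebra.lift ℂ ρ.generatorAction, by
    classical
    intro p q h
    induction h with
    | one =>
      rw [TensorAlgebra.lift_ι_apply, map_one, generatorAction_left]
      simpa using ρ.sum_e
    | mul b c =>
      simp only [map_mul, TensorAlgebra.lift_ι_apply, generatorAction_left]
      rw [Finset.sum_mul]
      refine Finset.sum_congr rfl fun i hi => ?_
      rw [Finset.mul_sum, Finset.sum_eq_single i]
      · rw [smul_mul_smul_comm, ρ.e_mul_self, Pi.mul_apply]
      · intro j _ hj
        rw [smul_mul_smul_comm, ρ.e_mul_of_ne _ _ hj.symm, smul_zero]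
      · exact fun h => (h hi).elim
    | left b y =>
      simp only [map_mul, TensorAlgebra.lift_ι_apply, generatorAction_left, generatorAction_right]
      rw [Finset.mul_sum]
      refine Finset.sum_congr rfl fun a ha => ?_
      rw [Finset.sum_mul, Finset.sum_eq_single (head a)]
      · rw [smul_mul_smul_comm, ρ.e_head_mul, lact]
      · intro j _ hj
        rw [smul_mul_smul_comm, ρ.e_mul_of_ne_head hj, smul_zero]
      · exact fun h => (h (mem_arrowsIn.1 ha).1).elim
    | right y b =>
      simp only [map_mul, TensorAlgebra.lift_ι_apply, generatorAction_left, generatorAction_right]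
      rw [Finset.sum_mul]
      refine Finset.sum_congr rfl fun a ha => ?_
      rw [Finset.mul_sum, Finset.sum_eq_single (tail a)]
      · rw [smul_mul_smul_comm, ρ.mul_e_tail, ract]
      · intro j _ hj
        rw [smul_mul_smul_comm, ρ.mul_e_of_ne_tail hj, smul_zero]
      · exact fun h => (h (mem_arrowsIn.1 ha).2).elim⟩

lemma pathAction_idem (i : I) : ρ.pathAction (idem i) = ρ.e i := by
  classical
  rw [idem, ofVertex, pathAction, RingQuot.liftAlgHom_mkAlgHom_apply, TensorAlgebra.lift_ι_apply,
    generatorAction_left]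
  simp only [Pi.single_apply, ite_smul, one_smul, zero_smul, Finset.sum_ite_eq']
  split_ifs with h
  · rfl
  · exact (ρ.e_eq_zero h).symm

lemma pathAction_arrowElem (a : DoubleArrow I) : ρ.pathAction (arrowElem a) = ρ.x a := by
  classical
  rw [arrowElem, ofArrow, pathAction, RingQuot.liftAlgHom_mkAlgHom_apply,
    TensorAlgebra.lift_ι_apply, generatorAction_right]
  simp only [Pi.single_apply, ite_smul, one_smul, zero_smul, Finset.sum_ite_eq']
  split_ifs with h
  · rfl
  · exact (ρ.x_eq_zero h).symm

/-- The kernel of an action on a finite-dimensional space has finite codimension, hence is closed,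
so it is one of the ideals whose intersection is taken. -/
lemma relationIdeal_le_ker [FiniteDimensional ℂ M] :
    relationIdeal lam ≤ TwoSidedIdeal.ker ρ.pathAction := by
  refine sInf_le ⟨fun i => ?_, ?_⟩
  · rw [TwoSidedIdeal.mem_ker, map_sub, relator_eq_sum, map_sum, map_smul, pathAction_idem,
      ← ρ.moment, sub_eq_zero]
    simp only [map_smul, map_mul, pathAction_arrowElem]
  · letI := finiteCodimTopology (CompletedPathAlgebra I)
    rw [← isOpen_compl_iff]
    intro p hp
    -- Translating by an element of the kernel cannot lead from its complement into it.
    refine ⟨LinearMap.ker ρ.pathAction.toLinearMap, Submodule.CoFG.ker _, fun q hq h => hp ?_⟩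
    rw [SetLike.mem_coe, TwoSidedIdeal.mem_ker] at h ⊢
    have hq' : ρ.pathAction q = 0 := hq
    rwa [map_add, hq', add_zero] at h

/-- The action of the continuous deformed preprojective algebra. -/
def action [FiniteDimensional ℂ M] : ContPreprojective lam →ₐ[ℂ] Module.End ℂ M :=
  RingCon.liftₐ _ ρ.pathAction fun p q h => by
    have h1 := ρ.relationIdeal_le_ker ((TwoSidedIdeal.rel_iff _ _ _).1 h)
    rw [TwoSidedIdeal.mem_ker, map_sub, sub_eq_zero] at h1
    exact h1

lemma action_vertexIdem [FiniteDimensional ℂ M] (i : I) :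
    ρ.action (vertexIdem lam i) = ρ.e i := ρ.pathAction_idem i

/-- A representation as a module over the continuous deformed preprojective algebra. -/
abbrev toModule [FiniteDimensional ℂ M] : Module (ContPreprojective lam) M :=
  Module.compHom M ρ.action.toRingHom

lemma iSupIndep_range_e : iSupIndep fun i => LinearMap.range (ρ.e i) := by
  intro i
  rw [Submodule.disjoint_def]
  rintro _ ⟨y, rfl⟩ h
  have : ⨆ j, ⨆ (_ : j ≠ i), LinearMap.range (ρ.e j) ≤ LinearMap.ker (ρ.e i) := by
    refine iSup₂_le fun j hj => ?_
    rintro _ ⟨z, rfl⟩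
    exact LinearMap.congr_fun (ρ.e_mul_of_ne i j hj.symm) z
  have h1 : (ρ.e i * ρ.e i) y = 0 := this h
  rwa [ρ.e_mul_self] at h1

lemma iSup_range_e : ⨆ i, LinearMap.range (ρ.e i) = ⊤ := by
  rw [eq_top_iff]
  intro y _
  have : y = ∑ i ∈ ρ.vertices, ρ.e i y := by
    rw [← LinearMap.sum_apply, ρ.sum_e, Module.End.one_apply]
  rw [this]
  exact sum_mem fun i _ => Submodule.mem_iSup_of_mem i ⟨y, rfl⟩

/-- The representation `ρ` has dimension vector `α`. -/
def HasDim (α : I →₀ ℕ) : Prop := ∀ i, Module.finrank ℂ (LinearMap.range (ρ.e i)) = α i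

lemma hasDimensionVector [FiniteDimensional ℂ M] {α : I →₀ ℕ} (h : ρ.HasDim α) :
    letI := ρ.toModule
    ∃ _ : IsScalarTower ℂ (ContPreprojective lam) M, HasDimensionVector lam M α := by
  let := ρ.toModule
  have : IsScalarTower ℂ (ContPreprojective lam) M := ⟨fun c p m => by
    change ρ.action (c • p) m = c • ρ.action p m
    rw [map_smul]; rfl⟩
  have hv : ∀ i, vertexSpace lam M i = LinearMap.range (ρ.e i) := by
    intro i
    rw [vertexSpace, ← ρ.action_vertexIdem]
    rfl
  refine ⟨this, ?_, ?_, ?_⟩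
  · simp only [funext hv]
    exact ρ.iSupIndep_range_e
  · simp only [hv]
    exact ρ.iSup_range_e
  · intro i
    rw [hv, ← h i, Module.finrank_eq_rank]

end MomentRep

section OfModule

variable (lam : I → ℂ) (M : Type*) [AddCommGroup M] [Module ℂ M] [Module (ContPreprojective lam) M]
  [IsScalarTower ℂ (ContPreprojective lam) M]

/-- The action of the completed path algebra on a representation. -/
def moduleAction : CompletedPathAlgebra I →ₐ[ℂ] Module.End ℂ M :=
  (Algebra.lsmul ℂ ℂ M).comp ((relationIdeal lam).ringCon.mkₐ ℂ)

lemma moduleAction_apply (p : CompletedPathAlgebra I) (m : M) :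
    moduleAction lam M p m = (relationIdeal lam).ringCon.mk' p • m := rfl

lemma moduleAction_relator (i : I) :
    moduleAction lam M (relator i) = lam i • moduleAction lam M (idem i) := by
  have h : relator i - lam i • idem i ∈ relationIdeal lam := by
    rw [relationIdeal, TwoSidedIdeal.mem_sInf]
    exact fun K hK => hK.1 i
  have h1 : (relationIdeal lam).ringCon.mk' (relator i) =
      (relationIdeal lam).ringCon.mk' (lam i • idem i) :=
    Quotient.sound ((TwoSidedIdeal.rel_iff _ _ _).2 h)
  ext m
  rw [← map_smul, moduleAction_apply, moduleAction_apply, h1]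

/-- The operators on a representation that is the sum of finitely many of its vertex spaces. -/
def MomentRep.ofModule {s : Finset I} (hs : ∑ i ∈ s, moduleAction lam M (idem i) = 1) :
    MomentRep lam M where
  e i := moduleAction lam M (idem i)
  x a := moduleAction lam M (arrowElem a)
  e_mul_self i := by rw [← map_mul, idem_mul_self]
  e_mul_of_ne i j hij := by rw [← map_mul, idem_mul_of_ne hij, map_zero]
  e_head_mul a := by rw [← map_mul, idem_head_mul_arrowElem]
  mul_e_tail a := by rw [← map_mul, arrowElem_mul_idem_tail]
  moment i := by
    rw [← moduleAction_relator, relator_eq_sum, map_sum]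
    simp only [map_smul, map_mul]
  vertices := s
  sum_e := hs

variable {lam M} {α : I →₀ ℕ} (h : HasDimensionVector lam M α)

namespace HasDimensionVector

include h

/-- Vertex spaces outside the support of α have rank 0, so M is already the sum of finitely many
vertex spaces. -/
lemma sum_idem : ∑ i ∈ α.support, moduleAction lam M (idem i) = 1 := by
  ext m
  rw [Module.End.one_apply]
  have hm : m ∈ ⨆ i, vertexSpace lam M i := by rw [h.iSup_eq_top]; trivial
  induction hm using Submodule.iSup_induction' with
  | mem i y hy =>
    by_cases hi : i ∈ α.support
    · obtain ⟨z, rfl⟩ := hy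
      change (∑ i ∈ α.support, moduleAction lam M (idem i)) (moduleAction lam M (idem i) z) =
        moduleAction lam M (idem i) z
      rw [← Module.End.mul_apply, Finset.sum_mul, Finset.sum_eq_single i]
      · rw [← map_mul, idem_mul_self]
      · intro j _ hj
        rw [← map_mul, idem_mul_of_ne hj, map_zero]
      · exact fun h => (h hi).elim
    · have h0 := h.rank_eq i
      rw [Finsupp.notMem_support_iff.1 hi, Nat.cast_zero, Submodule.rank_eq_zero] at h0
      rw [h0, Submodule.mem_bot] at hy
      rw [hy, map_zero]
  | zero => rw [map_zero]
  | add y z _ _ hy hz => rw [map_add, hy, hz]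

lemma finite (i : I) : FiniteDimensional ℂ (vertexSpace lam M i) :=
  Module.rank_lt_aleph0_iff.1 (by rw [h.rank_eq]; exact Cardinal.natCast_lt_aleph0)

lemma finiteDimensional : FiniteDimensional ℂ M := by
  have := h.finite
  have h1 : α.support.sup (vertexSpace lam M) = ⊤ := by
    rw [eq_top_iff]
    intro m _
    have : m = ∑ i ∈ α.support, moduleAction lam M (idem i) m := by
      rw [← LinearMap.sum_apply, h.sum_idem, Module.End.one_apply]
    rw [this]
    exact sum_mem fun i hi => Finset.le_sup (f := vertexSpace lam M) hi ⟨m, rfl⟩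
  have h2 : (α.support.sup (vertexSpace lam M)).FG :=
    Submodule.fg_finset_sup _ _ fun i _ => Module.Finite.iff_fg.1 (h.finite i)
  exact ⟨h1 ▸ h2⟩

/-- The operators on a representation with a dimension vector. -/
def toMomentRep : MomentRep lam M := MomentRep.ofModule lam M h.sum_idem

lemma hasDim : h.toMomentRep.HasDim α := fun i =>
  Module.finrank_eq_of_rank_eq (h.rank_eq i)

variable {N : Type*} [AddCommGroup N] [Module ℂ N] [Module (ContPreprojective lam) N]
  [IsScalarTower ℂ (ContPreprojective lam) N] {β : I →₀ ℕ} (h' : HasDimensionVector lam N β)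

include h' in
/-- A linear map that commutes with the operators is linear over the algebra. -/
lemma map_smul_of_commute (f : M →ₗ[ℂ] N)
    (he : ∀ i, f ∘ₗ h.toMomentRep.e i = h'.toMomentRep.e i ∘ₗ f)
    (hx : ∀ a, f ∘ₗ h.toMomentRep.x a = h'.toMomentRep.x a ∘ₗ f)
    (p : ContPreprojective lam) (m : M) : f (p • m) = p • f m := by
  classical
  -- A common finite set of vertices makes an infinite combination act on M and on N by sums over
  -- the same index set.
  have h1 := h.toMomentRep.sum_e_of_subset (s := α.support ∪ β.support)
    (Finset.subset_union_left : α.support ⊆ _)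
  have h2 := h'.toMomentRep.sum_e_of_subset (s := α.support ∪ β.support)
    (Finset.subset_union_right : β.support ⊆ _)
  have he' : ∀ i m, f (moduleAction lam M (idem i) m) = moduleAction lam N (idem i) (f m) :=
    fun i m => LinearMap.congr_fun (he i) m
  have hx' : ∀ a m, f (moduleAction lam M (arrowElem a) m) =
      moduleAction lam N (arrowElem a) (f m) := fun a m => LinearMap.congr_fun (hx a) m
  obtain ⟨p, rfl⟩ := RingCon.mk'_surjective _ p
  rw [← moduleAction_apply, ← moduleAction_apply]
  induction p using completedPathAlgebra_induction generalizing m with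
  | vertex b =>
    rw [map_ofVertex_eq_sum _ h1, map_ofVertex_eq_sum _ h2]
    simp [LinearMap.sum_apply, he']
  | arrow y =>
    rw [map_ofArrow_eq_sum _ h1, map_ofArrow_eq_sum _ h2]
    simp [LinearMap.sum_apply, hx']
  | scalar c => simp [Algebra.algebraMap_eq_smul_one]
  | add p q hp hq => simp [hp, hq]
  | mul p q hp hq => simp [hp, hq]

end HasDimensionVector

end OfModule

end MomentReps

/-! ### Blocks cut out by idempotents and linear algebra of pairings -/

section Blocks

variable {M N : Type*} [AddCommGroup M] [Module ℂ M] [AddCommGroup N] [Module ℂ N]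

lemma linearMap_sum_comp {P ι : Type*} [AddCommGroup P] [Module ℂ P] (s : Finset ι)
    (f : ι → N →ₗ[ℂ] P) (g : M →ₗ[ℂ] N) : (∑ i ∈ s, f i) ∘ₗ g = ∑ i ∈ s, f i ∘ₗ g := by
  ext; simp [LinearMap.sum_apply]

lemma linearMap_comp_sum {P ι : Type*} [AddCommGroup P] [Module ℂ P] (s : Finset ι)
    (g : N →ₗ[ℂ] P) (f : ι → M →ₗ[ℂ] N) : g ∘ₗ (∑ i ∈ s, f i) = ∑ i ∈ s, g ∘ₗ f i := by
  ext; simp [LinearMap.sum_apply]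

/-- The linear maps `p ∘ f ∘ q`, for idempotent endomorphisms `p` and `q`. -/
def block (p : Module.End ℂ N) (q : Module.End ℂ M) : Submodule ℂ (M →ₗ[ℂ] N) where
  carrier := {f | p ∘ₗ f = f ∧ f ∘ₗ q = f}
  add_mem' := by
    rintro f g ⟨h1, h2⟩ ⟨h3, h4⟩
    exact ⟨by rw [LinearMap.comp_add, h1, h3], by rw [LinearMap.add_comp, h2, h4]⟩
  zero_mem' := by simp
  smul_mem' := by
    rintro c f ⟨h1, h2⟩
    exact ⟨by rw [LinearMap.comp_smul, h1], by rw [LinearMap.smul_comp, h2]⟩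

lemma mem_block {p : Module.End ℂ N} {q : Module.End ℂ M} {f : M →ₗ[ℂ] N} :
    f ∈ block p q ↔ p ∘ₗ f = f ∧ f ∘ₗ q = f := Iff.rfl

lemma comp_comp_mem_block {p : Module.End ℂ N} {q : Module.End ℂ M} (hp : p * p = p)
    (hq : q * q = q) (f : M →ₗ[ℂ] N) : p ∘ₗ f ∘ₗ q ∈ block p q := by
  refine mem_block.2 ⟨?_, ?_⟩
  · rw [← LinearMap.comp_assoc, ← Module.End.mul_eq_comp, hp]
  · rw [LinearMap.comp_assoc, LinearMap.comp_assoc, ← Module.End.mul_eq_comp q, hq]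

/-- Linear maps between the ranges of idempotent endomorphisms. -/
def blockEquiv {p : Module.End ℂ N} {q : Module.End ℂ M} (hp : p * p = p) (hq : q * q = q) :
    block p q ≃ₗ[ℂ] (LinearMap.range q →ₗ[ℂ] LinearMap.range p) where
  toFun f := p.rangeRestrict ∘ₗ f.1 ∘ₗ (LinearMap.range q).subtype
  invFun g := ⟨(LinearMap.range p).subtype ∘ₗ g ∘ₗ q.rangeRestrict, by
    refine mem_block.2 ⟨?_, ?_⟩
    · ext m
      obtain ⟨n, hn⟩ := (g (q.rangeRestrict m)).2
      simp only [LinearMap.comp_apply, Submodule.subtype_apply, ← hn]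
      exact LinearMap.congr_fun hp n
    · ext m
      have : q.rangeRestrict (q m) = q.rangeRestrict m :=
        Subtype.ext (LinearMap.congr_fun hq m)
      simp only [LinearMap.comp_apply, this]⟩
  map_add' f g := by ext; simp
  map_smul' c f := by ext; simp
  left_inv f := by
    ext m
    exact (LinearMap.congr_fun f.2.1 _).trans (LinearMap.congr_fun f.2.2 m)
  right_inv g := by
    ext ⟨_, m, rfl⟩
    obtain ⟨n, hn⟩ := (g ⟨q m, m, rfl⟩).2
    have : q.rangeRestrict (q m) = ⟨q m, m, rfl⟩ := Subtype.ext (LinearMap.congr_fun hq m)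
    simp only [LinearMap.comp_apply, Submodule.subtype_apply, this]
    rw [← hn]
    exact LinearMap.congr_fun hp n

lemma finrank_block [FiniteDimensional ℂ M] [FiniteDimensional ℂ N] {p : Module.End ℂ N}
    {q : Module.End ℂ M} (hp : p * p = p) (hq : q * q = q) :
    Module.finrank ℂ (block p q) =
      Module.finrank ℂ (LinearMap.range q) * Module.finrank ℂ (LinearMap.range p) := by
  rw [(blockEquiv hp hq).finrank_eq, Module.finrank_linearMap]

/-- Rank-one maps n ↦ l(n) m suffice: their traces against f are the numbers l(f m). -/
lemma eq_zero_of_trace_comp_eq_zero [FiniteDimensional ℂ N]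
    (f : M →ₗ[ℂ] N) (h : ∀ g : N →ₗ[ℂ] M, LinearMap.trace ℂ N (f ∘ₗ g) = 0) : f = 0 := by
  ext m
  refine (Module.forall_dual_apply_eq_zero_iff ℂ (f m)).1 fun l => ?_
  have h1 : f ∘ₗ l.smulRight m = l.smulRight (f m) := by ext; simp
  have h2 := h (l.smulRight m)
  rwa [h1, LinearMap.trace_smulRight] at h2

lemma finrank_add_finrank_le_of_orthogonal {U V : Type*} [AddCommGroup U] [Module ℂ U]
    [AddCommGroup V] [Module ℂ V] [FiniteDimensional ℂ V] (B : U →ₗ[ℂ] Module.Dual ℂ V)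
    (hB : Function.Injective B) (U' : Submodule ℂ U) (V' : Submodule ℂ V)
    (h : ∀ x ∈ U', ∀ y ∈ V', B x y = 0) :
    Module.finrank ℂ U' + Module.finrank ℂ V' ≤ Module.finrank ℂ V := by
  rw [← Subspace.finrank_add_finrank_dualAnnihilator_eq V', add_comm,
    (Submodule.equivMapOfInjective B hB U').finrank_eq]
  refine Nat.add_le_add_left (Submodule.finrank_mono ?_) _
  rintro _ ⟨x, hx, rfl⟩
  exact (Submodule.mem_dualAnnihilator _).2 (h x hx)

end Blocks

/-! ### The lower bound for dimensions of homomorphism spaces -/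

namespace MomentRep

variable {I : Type u} [Quiver.{v} I] [LocallyFiniteQuiver I]
  {lam : I → ℂ} {M N : Type*} [AddCommGroup M] [Module ℂ M] [AddCommGroup N] [Module ℂ N]

lemma sum_arrowsIn_moment (ρ : MomentRep lam M) {s : Finset I} (hs : ρ.vertices ⊆ s) :
    ∑ a ∈ arrowsIn s, arrowSign a • (ρ.x a * ρ.x (reverseArrow a)) =
      ∑ i ∈ s, lam i • ρ.e i := by
  rw [sum_arrowsIn_of_tail]
  · exact Finset.sum_congr rfl fun i _ => ρ.moment i
  · intro a ha
    rw [ρ.x_eq_zero_of_tail fun h => ha (hs h), zero_mul, smul_zero]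

/-- The space of homomorphisms of representations. -/
def homSpace (ρ : MomentRep lam M) (σ : MomentRep lam N) : Submodule ℂ (M →ₗ[ℂ] N) where
  carrier := {f | (∀ i, f ∘ₗ ρ.e i = σ.e i ∘ₗ f) ∧ ∀ a, f ∘ₗ ρ.x a = σ.x a ∘ₗ f}
  add_mem' := by
    rintro f g ⟨h1, h2⟩ ⟨h3, h4⟩
    constructor <;> intro i
    · rw [LinearMap.add_comp, LinearMap.comp_add, h1, h3]
    · rw [LinearMap.add_comp, LinearMap.comp_add, h2, h4]
  zero_mem' := by simp
  smul_mem' := by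
    rintro c f ⟨h1, h2⟩
    constructor <;> intro i
    · rw [LinearMap.smul_comp, LinearMap.comp_smul, h1]
    · rw [LinearMap.smul_comp, LinearMap.comp_smul, h2]

/-- Families of linear maps between the spaces at the vertices. -/
abbrev VertexMaps (ρ : MomentRep lam M) (σ : MomentRep lam N) (s : Finset I) : Type _ :=
  ∀ i : s, block (σ.e i) (ρ.e i)

/-- Families of linear maps from the spaces at the tails to the spaces at the heads of the
arrows. -/
abbrev ArrowMaps (ρ : MomentRep lam M) (σ : MomentRep lam N) (s : Finset I) : Type _ :=
  ∀ a : {a // a ∈ arrowsIn s}, block (σ.e (head a.1)) (ρ.e (tail a.1))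

variable (ρ : MomentRep lam M) (σ : MomentRep lam N) (s : Finset I)

/-- The block diagonal linear map. -/
def total : VertexMaps ρ σ s →ₗ[ℂ] (M →ₗ[ℂ] N) :=
  ∑ i, (block _ _).subtype ∘ₗ LinearMap.proj i

variable {ρ σ s}

lemma total_apply (θ : VertexMaps ρ σ s) : total ρ σ s θ = ∑ i, (θ i).1 := by
  simp [total, LinearMap.sum_apply]

lemma total_comp_e (θ : VertexMaps ρ σ s) (i : s) : total ρ σ s θ ∘ₗ ρ.e i = (θ i).1 := by
  rw [total_apply, linearMap_sum_comp, Finset.sum_eq_single i]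
  · exact (θ i).2.2
  · intro j _ hj
    rw [← (θ j).2.2, LinearMap.comp_assoc, ← Module.End.mul_eq_comp,
      ρ.e_mul_of_ne _ _ fun h => hj (Subtype.ext h), LinearMap.comp_zero]
  · simp

lemma e_comp_total (θ : VertexMaps ρ σ s) (i : s) : σ.e i ∘ₗ total ρ σ s θ = (θ i).1 := by
  rw [total_apply, linearMap_comp_sum, Finset.sum_eq_single i]
  · exact (θ i).2.1
  · intro j _ hj
    rw [← (θ j).2.1, ← LinearMap.comp_assoc, ← Module.End.mul_eq_comp,
      σ.e_mul_of_ne _ _ fun h => hj (Subtype.ext h.symm), LinearMap.zero_comp]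
  · simp

lemma total_comm (hρ : ρ.vertices ⊆ s) (hσ : σ.vertices ⊆ s) (θ : VertexMaps ρ σ s) (i : I) :
    total ρ σ s θ ∘ₗ ρ.e i = σ.e i ∘ₗ total ρ σ s θ := by
  by_cases hi : i ∈ s
  · exact (total_comp_e θ ⟨i, hi⟩).trans (e_comp_total θ ⟨i, hi⟩).symm
  · rw [ρ.e_eq_zero fun h => hi (hρ h), σ.e_eq_zero fun h => hi (hσ h), LinearMap.comp_zero,
      LinearMap.zero_comp]

lemma total_injective : Function.Injective (total ρ σ s) := by
  intro θ θ' h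
  ext1 i
  rw [Subtype.ext_iff, ← total_comp_e, ← total_comp_e, h]

variable (hρ : ρ.vertices ⊆ s) (hσ : σ.vertices ⊆ s)

/-- The differential, whose kernel is the space of homomorphisms. -/
def differential : VertexMaps ρ σ s →ₗ[ℂ] ArrowMaps ρ σ s :=
  LinearMap.pi fun a =>
    ((LinearMap.lcomp ℂ N (ρ.x a.1) - (σ.x a.1).compRight ℂ) ∘ₗ total ρ σ s).codRestrict _ <| by
      intro θ
      simp only [LinearMap.comp_apply, LinearMap.sub_apply, LinearMap.lcomp_apply',
        LinearMap.compRight_apply]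
      refine Submodule.sub_mem _ (mem_block.2 ⟨?_, ?_⟩) (mem_block.2 ⟨?_, ?_⟩)
      · rw [← LinearMap.comp_assoc, ← total_comm hρ hσ, LinearMap.comp_assoc,
          ← Module.End.mul_eq_comp, ρ.e_head_mul]
      · rw [LinearMap.comp_assoc, ← Module.End.mul_eq_comp (ρ.x _), ρ.mul_e_tail]
      · rw [← LinearMap.comp_assoc, ← Module.End.mul_eq_comp, σ.e_head_mul]
      · rw [LinearMap.comp_assoc, total_comm hρ hσ, ← LinearMap.comp_assoc,
          ← Module.End.mul_eq_comp (σ.x _), σ.mul_e_tail]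

lemma differential_apply (θ : VertexMaps ρ σ s) (a : {a // a ∈ arrowsIn s}) :
    (differential hρ hσ θ a).1 =
      total ρ σ s θ ∘ₗ ρ.x a.1 - σ.x a.1 ∘ₗ total ρ σ s θ := rfl

/-- A family of vertex maps killed by the differential assembles to a homomorphism; outside s all
arrows act by zero. -/
lemma finrank_ker_differential_le [FiniteDimensional ℂ M] [FiniteDimensional ℂ N] :
    Module.finrank ℂ (LinearMap.ker (differential hρ hσ)) ≤ Module.finrank ℂ (homSpace ρ σ) := by
  rw [(Submodule.equivMapOfInjective _ (total_injective (ρ := ρ) (σ := σ) (s := s)) _).finrank_eq]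
  refine Submodule.finrank_mono ?_
  rintro _ ⟨θ, hθ, rfl⟩
  refine ⟨total_comm hρ hσ θ, fun a => ?_⟩
  by_cases ha : a ∈ arrowsIn s
  · rw [← sub_eq_zero, ← differential_apply hρ hσ θ ⟨a, ha⟩, LinearMap.mem_ker.1 hθ]
    rfl
  · have h : ∀ t ⊆ s, a ∉ arrowsIn t := fun t ht h =>
      ha (mem_arrowsIn.2 ((mem_arrowsIn.1 h).imp (@ht _) (@ht _)))
    rw [ρ.x_eq_zero (h _ hρ), σ.x_eq_zero (h _ hσ), LinearMap.comp_zero, LinearMap.zero_comp]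

variable (s) in
/-- The reversal of arrows. -/
def revIn (a : {a // a ∈ arrowsIn s}) : {a // a ∈ arrowsIn s} :=
  ⟨reverseArrow a.1, mem_arrowsIn.2 (mem_arrowsIn.1 a.2).symm⟩

variable (ρ σ s) in
/-- The trace pairing `∑_a ± tr(φ_a ψ_{a*})`. -/
def tracePairing : ArrowMaps ρ σ s →ₗ[ℂ] ArrowMaps σ ρ s →ₗ[ℂ] ℂ :=
  LinearMap.mk₂ ℂ (fun φ ψ => ∑ a : {a // a ∈ arrowsIn s},
      arrowSign a.1 * LinearMap.trace ℂ N ((φ a).1 ∘ₗ (ψ (revIn s a)).1))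
    (fun φ φ' ψ => by simp [LinearMap.add_comp, mul_add, Finset.sum_add_distrib])
    (fun c φ ψ => by
      simp only [Pi.smul_apply, Submodule.coe_smul, LinearMap.smul_comp, map_smul, smul_eq_mul,
        Finset.mul_sum]
      exact Finset.sum_congr rfl fun _ _ => by ring)
    (fun φ ψ ψ' => by simp [LinearMap.comp_add, mul_add, Finset.sum_add_distrib])
    (fun c φ ψ => by
      simp only [Pi.smul_apply, Submodule.coe_smul, LinearMap.comp_smul, map_smul, smul_eq_mul,
        Finset.mul_sum]
      exact Finset.sum_congr rfl fun _ _ => by ring)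

lemma tracePairing_apply (φ : ArrowMaps ρ σ s) (ψ : ArrowMaps σ ρ s) :
    tracePairing ρ σ s φ ψ = ∑ a : {a // a ∈ arrowsIn s},
      arrowSign a.1 * LinearMap.trace ℂ N ((φ a).1 ∘ₗ (ψ (revIn s a)).1) := rfl

lemma tracePairing_injective [FiniteDimensional ℂ N] :
    Function.Injective (tracePairing ρ σ s) := by
  classical
  rw [injective_iff_map_eq_zero]
  intro φ hφ
  ext1 a
  refine Subtype.ext (eq_zero_of_trace_comp_eq_zero _ fun g => ?_)
  have hrev : revIn s (revIn s a) = a := Subtype.ext (reverseArrow_reverseArrow _)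
  -- An arbitrary test map g must first be compressed to the block. Cyclicity of the trace then lets
  -- φ_a absorb the two idempotents.
  let b : block (ρ.e (head (revIn s a).1)) (σ.e (tail (revIn s a).1)) :=
    ⟨_, comp_comp_mem_block (ρ.e_mul_self _) (σ.e_mul_self _) g⟩
  have h1 := LinearMap.congr_fun hφ (Pi.single (revIn s a) b)
  rw [tracePairing_apply, Finset.sum_eq_single a] at h1
  · rw [Pi.single_eq_same, LinearMap.zero_apply, mul_eq_zero] at h1
    have h2 := h1.resolve_left (arrowSign_ne_zero _)
    change LinearMap.trace ℂ N ((φ a).1 ∘ₗ ρ.e (tail a.1) ∘ₗ g ∘ₗ σ.e (head a.1)) = 0 at h2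
    rw [← LinearMap.comp_assoc, (φ a).2.2, ← LinearMap.comp_assoc, ← Module.End.mul_eq_comp,
      LinearMap.trace_mul_comm, Module.End.mul_eq_comp, ← LinearMap.comp_assoc, (φ a).2.1] at h2
    exact h2
  · intro c _ hc
    rw [Pi.single_eq_of_ne]
    · simp
    · intro h
      refine hc ?_
      rw [← hrev, ← h]
      exact Subtype.ext (reverseArrow_reverseArrow _).symm
  · simp

/-- Of the four terms in the expanded product, the two mixed ones cancel under reversal of arrows.
The relations turn the other two into traces weighted by λ, which agree up to sign because block
diagonal maps commute with the idempotents. -/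
lemma tracePairing_differential (θ : VertexMaps ρ σ s) (θ' : VertexMaps σ ρ s) :
    tracePairing ρ σ s (differential hρ hσ θ) (differential hσ hρ θ') = 0 := by
  set t := total ρ σ s θ with ht
  set t' := total σ ρ s θ' with ht'
  let tr := LinearMap.trace ℂ N
  have h1 : tracePairing ρ σ s (differential hρ hσ θ) (differential hσ hρ θ') =
      ∑ a ∈ arrowsIn s, arrowSign a * tr ((t ∘ₗ ρ.x a - σ.x a ∘ₗ t) ∘ₗ
        (t' ∘ₗ σ.x (reverseArrow a) - ρ.x (reverseArrow a) ∘ₗ t')) := by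
    rw [← Finset.sum_coe_sort]
    rfl
  let A : DoubleArrow I → Module.End ℂ N := fun a => t ∘ₗ ρ.x a ∘ₗ t'
  have h2 : ∀ a, tr ((t ∘ₗ ρ.x a - σ.x a ∘ₗ t) ∘ₗ
        (t' ∘ₗ σ.x (reverseArrow a) - ρ.x (reverseArrow a) ∘ₗ t')) =
      tr (A a * σ.x (reverseArrow a)) - tr (t ∘ₗ (ρ.x a * ρ.x (reverseArrow a)) ∘ₗ t') -
        tr ((σ.x (reverseArrow a) * σ.x a) * (t ∘ₗ t')) + tr (A (reverseArrow a) * σ.x a) := by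
    intro a
    have h3 : tr ((σ.x (reverseArrow a) * σ.x a) * (t ∘ₗ t')) =
        tr (σ.x a * (t ∘ₗ t') * σ.x (reverseArrow a)) := by
      rw [mul_assoc]
      exact LinearMap.trace_mul_comm _ _ _
    have h4 : tr (A (reverseArrow a) * σ.x a) = tr (σ.x a * A (reverseArrow a)) :=
      LinearMap.trace_mul_comm _ _ _
    rw [h3, h4, ← map_sub, ← map_sub, ← map_add]
    congr 1
    simp only [LinearMap.sub_comp, LinearMap.comp_sub, Module.End.mul_eq_comp,
      LinearMap.comp_assoc, A]
    abel
  -- Reversing the summation index exchanges the two mixed terms and flips the sign.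
  have hcross : ∑ a ∈ arrowsIn s, arrowSign a * tr (A (reverseArrow a) * σ.x a) =
      - ∑ a ∈ arrowsIn s, arrowSign a * tr (A a * σ.x (reverseArrow a)) := by
    rw [← sum_arrowsIn_reverse, ← Finset.sum_neg_distrib]
    simp
  have hM : ∑ a ∈ arrowsIn s, arrowSign a * tr (t ∘ₗ (ρ.x a * ρ.x (reverseArrow a)) ∘ₗ t') =
      tr (t ∘ₗ (∑ i ∈ s, lam i • ρ.e i) ∘ₗ t') := by
    rw [← ρ.sum_arrowsIn_moment hρ, linearMap_sum_comp, linearMap_comp_sum, map_sum]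
    simp only [LinearMap.smul_comp, LinearMap.comp_smul, map_smul, smul_eq_mul]
  have hN : ∑ a ∈ arrowsIn s, arrowSign a * tr ((σ.x (reverseArrow a) * σ.x a) * (t ∘ₗ t')) =
      - tr ((∑ i ∈ s, lam i • σ.e i) * (t ∘ₗ t')) := by
    rw [← σ.sum_arrowsIn_moment hσ, Finset.sum_mul, map_sum, ← sum_arrowsIn_reverse,
      ← Finset.sum_neg_distrib]
    simp only [smul_mul_assoc, map_smul, smul_eq_mul, arrowSign_reverseArrow,
      reverseArrow_reverseArrow, neg_mul]
  have hcomm : t ∘ₗ (∑ i ∈ s, lam i • ρ.e i) ∘ₗ t' = (∑ i ∈ s, lam i • σ.e i) * (t ∘ₗ t') := by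
    rw [Module.End.mul_eq_comp, ← LinearMap.comp_assoc, ← LinearMap.comp_assoc]
    refine congrArg (fun f : M →ₗ[ℂ] N => f ∘ₗ t') ?_
    rw [linearMap_comp_sum, linearMap_sum_comp]
    refine Finset.sum_congr rfl fun i _ => ?_
    rw [LinearMap.comp_smul, LinearMap.smul_comp, total_comm hρ hσ]
  rw [h1]
  simp only [h2, mul_add, mul_sub, Finset.sum_add_distrib, Finset.sum_sub_distrib]
  rw [hcross, hM, hN, hcomm]
  ring

lemma finrank_vertexMaps [FiniteDimensional ℂ M] [FiniteDimensional ℂ N] {α β : I →₀ ℕ}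
    (hα : ρ.HasDim α) (hβ : σ.HasDim β) :
    Module.finrank ℂ (VertexMaps ρ σ s) = ∑ i ∈ s, α i * β i := by
  rw [Module.finrank_pi_fintype, ← Finset.sum_coe_sort s]
  refine Finset.sum_congr rfl fun i _ => ?_
  rw [finrank_block (σ.e_mul_self _) (ρ.e_mul_self _), hα, hβ]

lemma finrank_arrowMaps [FiniteDimensional ℂ M] [FiniteDimensional ℂ N] {α β : I →₀ ℕ}
    (hα : ρ.HasDim α) (hβ : σ.HasDim β) :
    Module.finrank ℂ (ArrowMaps ρ σ s) = ∑ a ∈ arrowsIn s, α (tail a) * β (head a) := by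
  rw [Module.finrank_pi_fintype, ← Finset.sum_coe_sort (arrowsIn s)]
  refine Finset.sum_congr rfl fun a _ => ?_
  rw [finrank_block (σ.e_mul_self _) (ρ.e_mul_self _), hα, hβ]

lemma HasDim.support_subset {α : I →₀ ℕ} (hα : ρ.HasDim α) : α.support ⊆ ρ.vertices := by
  intro i hi
  by_contra h
  have := hα i
  rw [ρ.e_eq_zero h, LinearMap.range_zero, finrank_bot] at this
  exact Finsupp.mem_support_iff.1 hi this.symm

/-- The symmetrized Ringel form bounds the dimensions of the spaces of homomorphisms from below. -/
theorem symForm_le [FiniteDimensional ℂ M] [FiniteDimensional ℂ N] {α β : I →₀ ℕ}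
    (hα : ρ.HasDim α) (hβ : σ.HasDim β) :
    symForm (toIntVec α) (toIntVec β) ≤
      Module.finrank ℂ (homSpace ρ σ) + Module.finrank ℂ (homSpace σ ρ) := by
  classical
  have hρ : ρ.vertices ⊆ ρ.vertices ∪ σ.vertices := Finset.subset_union_left
  have hσ : σ.vertices ⊆ ρ.vertices ∪ σ.vertices := Finset.subset_union_right
  generalize ρ.vertices ∪ σ.vertices = s at hρ hσ
  rw [symForm_eq s (by rw [support_toIntVec]; exact hα.support_subset.trans hρ)
    (by rw [support_toIntVec]; exact hβ.support_subset.trans hσ)]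
  -- The ranks of the two differentials add up to at most the number of arrow parameters; each rank
  -- is the number of vertex parameters minus the dimension of a kernel.
  have h1 := finrank_add_finrank_le_of_orthogonal _ (tracePairing_injective (ρ := ρ) (σ := σ))
    (LinearMap.range (differential hρ hσ)) (LinearMap.range (differential hσ hρ)) (by
      rintro _ ⟨θ, rfl⟩ _ ⟨θ', rfl⟩
      exact tracePairing_differential hρ hσ θ θ')
  have h2 := LinearMap.finrank_range_add_finrank_ker (differential hρ hσ)
  have h3 := LinearMap.finrank_range_add_finrank_ker (differential hσ hρ)
  have h4 := finrank_ker_differential_le hρ hσ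
  have h5 := finrank_ker_differential_le hσ hρ
  rw [finrank_vertexMaps hα hβ] at h2
  rw [finrank_vertexMaps hβ hα] at h3
  rw [finrank_arrowMaps hβ hα] at h1
  have h6 : ∑ i ∈ s, β i * α i = ∑ i ∈ s, α i * β i :=
    Finset.sum_congr rfl fun i _ => mul_comm _ _
  have h7 : ∑ a ∈ arrowsIn s, β (tail a) * α (head a) =
      ∑ a ∈ arrowsIn s, α (tail a) * β (head a) := by
    rw [← sum_arrowsIn_reverse]
    exact Finset.sum_congr rfl fun i _ => mul_comm _ _
  simp only [toIntVec_apply]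
  rw [h6] at h3
  rw [h7] at h1
  have h8 : ∑ i ∈ s, (α i : ℤ) * β i = (∑ i ∈ s, α i * β i : ℕ) := by push_cast; rfl
  have h9 : ∑ a ∈ arrowsIn s, (α (tail a) : ℤ) * β (head a) =
    (∑ a ∈ arrowsIn s, α (tail a) * β (head a) : ℕ) := by push_cast; rfl
  rw [h8, h9]
  lia

end MomentRep

/-! ### Traces, direct sums and corners of representations -/

section

variable {I : Type u} [Quiver.{v} I] [LocallyFiniteQuiver I]

lemma trace_eq_finrank_range {M : Type*} [AddCommGroup M] [Module ℂ M] [FiniteDimensional ℂ M]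
    {p : Module.End ℂ M} (hp : p * p = p) :
    LinearMap.trace ℂ M p = Module.finrank ℂ (LinearMap.range p) :=
  (LinearMap.IsIdempotentElem.isProj_range p hp).trace

lemma sum_prodMap {M N ι : Type*} [AddCommGroup M] [Module ℂ M] [AddCommGroup N] [Module ℂ N]
    (s : Finset ι) (f : ι → Module.End ℂ M) (g : ι → Module.End ℂ N) :
    ∑ k ∈ s, (f k).prodMap (g k) = (∑ k ∈ s, f k).prodMap (∑ k ∈ s, g k) := by
  ext m <;> simp [LinearMap.sum_apply, Prod.fst_sum, Prod.snd_sum]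

namespace MomentRep

variable {lam : I → ℂ} {M N : Type*} [AddCommGroup M] [Module ℂ M] [AddCommGroup N] [Module ℂ N]

/-- In characteristic zero the rank of an idempotent is its trace. Traces are additive and invariant
under conjugation, so dimension vectors can be computed without describing the ranges. -/
lemma hasDim_iff_trace [FiniteDimensional ℂ M] (ρ : MomentRep lam M) {α : I →₀ ℕ} :
    ρ.HasDim α ↔ ∀ i, LinearMap.trace ℂ M (ρ.e i) = α i := by
  refine forall_congr' fun i => ?_
  rw [trace_eq_finrank_range (ρ.e_mul_self i), Nat.cast_inj]

/-- The transport of a representation along a linear equivalence. -/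
def congr (ρ : MomentRep lam M) (f : M ≃ₗ[ℂ] N) : MomentRep lam N where
  e i := f.conjAlgEquiv ℂ (ρ.e i)
  x a := f.conjAlgEquiv ℂ (ρ.x a)
  e_mul_self i := by rw [← map_mul, ρ.e_mul_self]
  e_mul_of_ne i j h := by rw [← map_mul, ρ.e_mul_of_ne i j h, map_zero]
  e_head_mul a := by rw [← map_mul, ρ.e_head_mul]
  mul_e_tail a := by rw [← map_mul, ρ.mul_e_tail]
  moment i := by simp only [← map_mul, ← map_smul, ← map_sum, ρ.moment]
  vertices := ρ.vertices
  sum_e := by rw [← map_sum, ρ.sum_e, map_one]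

lemma HasDim.congr [FiniteDimensional ℂ M] [FiniteDimensional ℂ N] {ρ : MomentRep lam M}
    {α : I →₀ ℕ} (h : ρ.HasDim α) (f : M ≃ₗ[ℂ] N) : (ρ.congr f).HasDim α := by
  rw [hasDim_iff_trace] at h ⊢
  intro i
  rw [← h]
  exact LinearMap.trace_conj' _ _

/-- The direct sum of two representations. -/
def directSum (ρ : MomentRep lam M) (σ : MomentRep lam N) : MomentRep lam (M × N) := by
  classical
  exact
  { e i := (ρ.e i).prodMap (σ.e i)
    x a := (ρ.x a).prodMap (σ.x a)
    e_mul_self i := by rw [LinearMap.prodMap_mul, ρ.e_mul_self, σ.e_mul_self]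
    e_mul_of_ne i j h := by
      rw [LinearMap.prodMap_mul, ρ.e_mul_of_ne i j h, σ.e_mul_of_ne i j h, LinearMap.prodMap_zero]
    e_head_mul a := by rw [LinearMap.prodMap_mul, ρ.e_head_mul, σ.e_head_mul]
    mul_e_tail a := by rw [LinearMap.prodMap_mul, ρ.mul_e_tail, σ.mul_e_tail]
    moment i := by
      simp only [LinearMap.prodMap_mul, ← LinearMap.prodMap_smul, sum_prodMap, ρ.moment,
        σ.moment]
    vertices := ρ.vertices ∪ σ.vertices
    sum_e := by
      have h1 := ρ.sum_e_of_subset (Finset.subset_union_left (s₂ := σ.vertices))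
      have h2 := σ.sum_e_of_subset (Finset.subset_union_right (s₁ := ρ.vertices))
      rw [sum_prodMap, h1, h2, LinearMap.prodMap_one] }

lemma HasDim.directSum [FiniteDimensional ℂ M] [FiniteDimensional ℂ N] {ρ : MomentRep lam M}
    {σ : MomentRep lam N} {α β : I →₀ ℕ} (hα : ρ.HasDim α) (hβ : σ.HasDim β) :
    (ρ.directSum σ).HasDim (α + β) := by
  rw [hasDim_iff_trace] at hα hβ ⊢
  intro i
  rw [Finsupp.add_apply, Nat.cast_add, ← hα, ← hβ]
  exact LinearMap.trace_prodMap' _ _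

open Classical in
/-- The one-dimensional representation at the vertex `i`. -/
def single {i : I} (h : lam i = 0) : MomentRep lam ℂ where
  e j := if j = i then 1 else 0
  x _ := 0
  e_mul_self j := by split_ifs <;> simp
  e_mul_of_ne j k h := by
    split_ifs <;> simp_all
  e_head_mul a := by simp
  mul_e_tail a := by simp
  moment j := by
    split_ifs with hj
    · simp [hj, h]
    · simp
  vertices := {i}
  sum_e := by simp

lemma hasDim_single {i : I} (h : lam i = 0) : (single h).HasDim (Finsupp.single i 1) := by
  classical
  rw [hasDim_iff_trace]
  intro j
  simp only [single, Finsupp.single_apply, eq_comm (a := i)]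
  split_ifs <;> simp

end MomentRep

namespace MomentOperators

variable {lam : I → ℂ} {L : Type*} [AddCommGroup L] [Module ℂ L] (ρ : MomentOperators lam L)
  (s : Finset I)

/-- The projection onto `⨁ e_i L`. -/
def cornerProj : Module.End ℂ L := ∑ i ∈ s, ρ.e i

/-- The compression of an endomorphism to `⨁ e_i L`. -/
def corner : Module.End ℂ L →ₗ[ℂ] Module.End ℂ (LinearMap.range (ρ.cornerProj s)) where
  toFun f := (ρ.cornerProj s).rangeRestrict ∘ₗ f ∘ₗ (LinearMap.range (ρ.cornerProj s)).subtype
  map_add' f g := by rw [LinearMap.add_comp, LinearMap.comp_add]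
  map_smul' c f := by rw [LinearMap.smul_comp, LinearMap.comp_smul, RingHom.id_apply]

/-- Compression is not multiplicative in general, but it is when the right factor already lands in
the corner; every e_i and x_a does. -/
lemma corner_mul (f : Module.End ℂ L) {g : Module.End ℂ L} (h : ρ.cornerProj s * g = g) :
    ρ.corner s (f * g) = ρ.corner s f * ρ.corner s g := by
  ext m
  have := LinearMap.congr_fun h m.1
  change ρ.cornerProj s (f (g m.1)) = ρ.cornerProj s (f ((ρ.cornerProj s * g) m.1))
  rw [this]

variable {s} (hs : ∀ i, i ∉ s → ρ.e i = 0)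

include hs

lemma cornerProj_mul_e (i : I) : ρ.cornerProj s * ρ.e i = ρ.e i := by
  by_cases hi : i ∈ s
  · rw [cornerProj, Finset.sum_mul, Finset.sum_eq_single i]
    · exact ρ.e_mul_self i
    · exact fun j _ hj => ρ.e_mul_of_ne _ _ hj
    · exact fun h => (h hi).elim
  · rw [hs i hi, mul_zero]

lemma cornerProj_mul_x (a : DoubleArrow I) : ρ.cornerProj s * ρ.x a = ρ.x a := by
  rw [← ρ.e_head_mul, ← mul_assoc, ρ.cornerProj_mul_e hs]

/-- The representation on `⨁ e_i L`. -/
def toMomentRep : MomentRep lam (LinearMap.range (ρ.cornerProj s)) where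
  e i := ρ.corner s (ρ.e i)
  x a := ρ.corner s (ρ.x a)
  e_mul_self i := by rw [← corner_mul _ _ _ (ρ.cornerProj_mul_e hs i), ρ.e_mul_self]
  e_mul_of_ne i j h := by
    rw [← corner_mul _ _ _ (ρ.cornerProj_mul_e hs j), ρ.e_mul_of_ne i j h, map_zero]
  e_head_mul a := by rw [← corner_mul _ _ _ (ρ.cornerProj_mul_x hs a), ρ.e_head_mul]
  mul_e_tail a := by rw [← corner_mul _ _ _ (ρ.cornerProj_mul_e hs _), ρ.mul_e_tail]
  moment i := by
    rw [← map_smul, ← ρ.moment, map_sum]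
    refine Finset.sum_congr rfl fun a _ => ?_
    rw [map_smul, corner_mul _ _ _ (ρ.cornerProj_mul_x hs _)]
  vertices := s
  sum_e := by
    rw [← map_sum]
    ext ⟨_, m, rfl⟩
    have h : ρ.cornerProj s * ρ.cornerProj s = ρ.cornerProj s := by
      refine (Finset.mul_sum _ _ _).trans ?_
      exact Finset.sum_congr rfl fun i _ => ρ.cornerProj_mul_e hs i
    change (ρ.cornerProj s * (ρ.cornerProj s * ρ.cornerProj s)) m = ρ.cornerProj s m
    rw [h, h]

lemma hasDim_toMomentRep [FiniteDimensional ℂ L] {α : I →₀ ℕ}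
    (h : ∀ i, LinearMap.trace ℂ L (ρ.e i) = α i) : (ρ.toMomentRep hs).HasDim α := by
  rw [MomentRep.hasDim_iff_trace]
  intro i
  rw [← h]
  change LinearMap.trace ℂ _ ((ρ.cornerProj s).rangeRestrict ∘ₗ ρ.e i ∘ₗ
    (LinearMap.range (ρ.cornerProj s)).subtype) = _
  rw [← LinearMap.trace_comp_comm', LinearMap.comp_assoc]
  change LinearMap.trace ℂ L (ρ.e i * ρ.cornerProj s) = _
  rw [LinearMap.trace_mul_comm, ρ.cornerProj_mul_e hs i]

end MomentOperators

end

/-! ### Reflection functors and existence of representations -/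

section

section BlockMatrices

variable {M F : Type*} [AddCommGroup M] [Module ℂ M] [AddCommGroup F] [Module ℂ F]

/-- The endomorphism of `M × F` given by a block matrix. -/
def blockMatrix (a : Module.End ℂ M) (b : F →ₗ[ℂ] M) (c : M →ₗ[ℂ] F) (d : Module.End ℂ F) :
    Module.End ℂ (M × F) :=
  (a.coprod b).prod (c.coprod d)

lemma blockMatrix_mul (a a' : Module.End ℂ M) (b b' : F →ₗ[ℂ] M) (c c' : M →ₗ[ℂ] F)
    (d d' : Module.End ℂ F) :
    blockMatrix a b c d * blockMatrix a' b' c' d' =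
      blockMatrix (a * a' + b ∘ₗ c') (a ∘ₗ b' + b ∘ₗ d') (c ∘ₗ a' + d ∘ₗ c')
        (c ∘ₗ b' + d * d') := by
  ext <;> simp [blockMatrix]

lemma blockMatrix_zero : blockMatrix (0 : Module.End ℂ M) 0 0 (0 : Module.End ℂ F) = 0 := by
  ext <;> simp [blockMatrix]

lemma smul_blockMatrix (z : ℂ) (a : Module.End ℂ M) (b : F →ₗ[ℂ] M) (c : M →ₗ[ℂ] F)
    (d : Module.End ℂ F) :
    z • blockMatrix a b c d = blockMatrix (z • a) (z • b) (z • c) (z • d) := by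
  ext <;> simp [blockMatrix]

lemma sum_blockMatrix {ι : Type*} (s : Finset ι) (a : ι → Module.End ℂ M)
    (d : ι → Module.End ℂ F) :
    ∑ k ∈ s, blockMatrix (a k) 0 0 (d k) = blockMatrix (∑ k ∈ s, a k) 0 0 (∑ k ∈ s, d k) := by
  ext <;> simp [blockMatrix, LinearMap.sum_apply, Prod.fst_sum, Prod.snd_sum]

lemma trace_blockMatrix [FiniteDimensional ℂ M] [FiniteDimensional ℂ F] (a : Module.End ℂ M)
    (d : Module.End ℂ F) : LinearMap.trace ℂ _ (blockMatrix a 0 0 d) =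
      LinearMap.trace ℂ M a + LinearMap.trace ℂ F d := by
  rw [← LinearMap.trace_prodMap']
  congr 1
  ext <;> simp [blockMatrix]

end BlockMatrices

lemma pairing_add {I : Type u} (lam : I → ℂ) (α β : I →₀ ℕ) :
    pairing lam (α + β) = pairing lam α + pairing lam β :=
  Finsupp.sum_add_index' (by simp) (by simp [mul_add])

lemma pairing_single {I : Type u} (lam : I → ℂ) (i : I) : pairing lam (Finsupp.single i 1) = lam i := by
  rw [pairing, Finsupp.sum_single_index] <;> simp

variable {I : Type u} [Quiver.{v} I] [LocallyFiniteQuiver I]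

namespace MomentRep

section Reflection

variable {lam : I → ℂ} {M : Type*} [AddCommGroup M] [Module ℂ M] (ρ : MomentRep lam M) (i : I)

/-- The direct sum of copies of `M` over the arrows with head `i`. -/
abbrev Neighbours (M : Type*) (i : I) : Type _ := {a // a ∈ inArrows i} → M

open Classical in
/-- The inclusion of the summand of an arrow; zero if its head is not `i`. -/
def slot (a : DoubleArrow I) : M →ₗ[ℂ] Neighbours M i :=
  if h : a ∈ inArrows i then LinearMap.single ℂ (fun _ : {a // a ∈ inArrows i} => M) ⟨a, h⟩ else 0

open Classical in
/-- The projection to the summand of an arrow; zero if its head is not `i`. -/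
def read (a : DoubleArrow I) : Neighbours M i →ₗ[ℂ] M :=
  if h : a ∈ inArrows i then LinearMap.proj ⟨a, h⟩ else 0

variable {i} in
lemma slot_eq_zero {a : DoubleArrow I} (h : head a ≠ i) : slot (M := M) i a = 0 :=
  dif_neg (by simpa using h)

variable {i} in
lemma read_eq_zero {a : DoubleArrow I} (h : head a ≠ i) : read (M := M) i a = 0 :=
  dif_neg (by simpa using h)

/-- The map from `M` to the sum over the neighbours of `i`. -/
def spread : M →ₗ[ℂ] Neighbours M i := LinearMap.pi fun a => ρ.x (reverseArrow a.1)

/-- The map to `M` from the sum over the neighbours of `i`. -/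
def collect : Neighbours M i →ₗ[ℂ] M :=
  ∑ a : {a // a ∈ inArrows i}, arrowSign a.1 • ρ.x a.1 ∘ₗ LinearMap.proj a

/-- The projection onto the sum of the spaces at the neighbours of `i`. -/
def tailProj : Module.End ℂ (Neighbours M i) :=
  LinearMap.pi fun a => ρ.e (tail a.1) ∘ₗ LinearMap.proj a

/-- The projection onto the kernel of `collect` along the image of `spread`. -/
def kerProj : Module.End ℂ (Neighbours M i) :=
  ρ.tailProj i - (lam i)⁻¹ • ρ.spread i ∘ₗ ρ.collect i

lemma collect_apply (f : Neighbours M i) :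
    ρ.collect i f = ∑ a, arrowSign a.1 • ρ.x a.1 (f a) := by
  simp [collect, LinearMap.sum_apply]

/-- This is the relation at i. For λ_i ≠ 0 it makes e_i M a direct summand of the sum of the spaces
at the neighbours; the reflection replaces it by the complement. -/
lemma collect_comp_spread : ρ.collect i ∘ₗ ρ.spread i = lam i • ρ.e i := by
  rw [← ρ.moment, ← Finset.sum_coe_sort]
  ext m
  simp [collect_apply, spread, LinearMap.sum_apply]

lemma tailProj_comp_spread : ρ.tailProj i ∘ₗ ρ.spread i = ρ.spread i := by
  ext m a
  exact LinearMap.congr_fun (ρ.e_head_mul (reverseArrow a.1)) m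

lemma collect_comp_tailProj : ρ.collect i ∘ₗ ρ.tailProj i = ρ.collect i := by
  refine LinearMap.ext fun f => ?_
  rw [LinearMap.comp_apply, collect_apply, collect_apply]
  refine Finset.sum_congr rfl fun a _ => congrArg (arrowSign a.1 • ·) ?_
  exact LinearMap.congr_fun (ρ.mul_e_tail a.1) (f a)

lemma e_comp_collect : ρ.e i ∘ₗ ρ.collect i = ρ.collect i := by
  refine LinearMap.ext fun f => ?_
  rw [LinearMap.comp_apply, collect_apply, map_sum]
  refine Finset.sum_congr rfl fun a _ => ?_
  rw [map_smul]
  have h := LinearMap.congr_fun (ρ.e_head_mul a.1) (f a)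
  rw [mem_inArrows.1 a.2] at h
  exact congrArg (arrowSign a.1 • ·) h

lemma tailProj_mul_self : ρ.tailProj i * ρ.tailProj i = ρ.tailProj i := by
  refine LinearMap.ext fun f => funext fun a => ?_
  exact LinearMap.congr_fun (ρ.e_mul_self (tail a.1)) (f a)

lemma kerProj_mul_tailProj : ρ.kerProj i * ρ.tailProj i = ρ.kerProj i := by
  rw [kerProj, sub_mul, tailProj_mul_self, smul_mul_assoc, Module.End.mul_eq_comp,
    LinearMap.comp_assoc, collect_comp_tailProj]

variable {i}

/-- The image is killed by `collect` and fixed by `tailProj`, so the correction term vanishes on it.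
-/
lemma kerProj_mul_self (hi : lam i ≠ 0) : ρ.kerProj i * ρ.kerProj i = ρ.kerProj i := by
  have h1 : ρ.collect i ∘ₗ ρ.kerProj i = 0 := by
    rw [kerProj, LinearMap.comp_sub, collect_comp_tailProj, LinearMap.comp_smul,
      ← LinearMap.comp_assoc, collect_comp_spread, LinearMap.smul_comp, e_comp_collect,
      inv_smul_smul₀ hi, sub_self]
  have h2 : ρ.tailProj i ∘ₗ ρ.kerProj i = ρ.kerProj i := by
    rw [kerProj, LinearMap.comp_sub, ← Module.End.mul_eq_comp, tailProj_mul_self,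
      LinearMap.comp_smul, ← LinearMap.comp_assoc, tailProj_comp_spread]
  calc ρ.kerProj i * ρ.kerProj i = (ρ.tailProj i - (lam i)⁻¹ • ρ.spread i ∘ₗ ρ.collect i) ∘ₗ
        ρ.kerProj i := rfl
    _ = ρ.kerProj i := by
      rw [LinearMap.sub_comp, h2, LinearMap.smul_comp, LinearMap.comp_assoc, h1,
        LinearMap.comp_zero, smul_zero, sub_zero]

/-- In the reflected representation this is the path from a neighbour of i through i and back along
the same edge. -/
lemma read_comp_kerProj_comp_slot {a : DoubleArrow I} (ha : head a = i) :
    read i a ∘ₗ ρ.kerProj i ∘ₗ slot i a =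
      ρ.e (tail a) - ((lam i)⁻¹ * arrowSign a) • (ρ.x (reverseArrow a) * ρ.x a) := by
  classical
  have ha' : a ∈ inArrows i := by simpa using ha
  rw [read, slot, dif_pos ha', dif_pos ha']
  ext m
  have h : ρ.collect i (Pi.single ⟨a, ha'⟩ m) = arrowSign a • ρ.x a m := by
    rw [collect_apply, Finset.sum_eq_single ⟨a, ha'⟩]
    · rw [Pi.single_eq_same]
    · intro b _ hb
      rw [Pi.single_eq_of_ne hb, map_zero, smul_zero]
    · simp
  simp [kerProj, tailProj, spread, h, smul_smul]

lemma sum_slot_read :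
    ∑ a ∈ inArrows i, slot i a ∘ₗ ρ.e (tail a) ∘ₗ read i a = ρ.tailProj i := by
  classical
  rw [← Finset.sum_coe_sort]
  refine LinearMap.ext fun f => funext fun a => ?_
  rw [LinearMap.sum_apply, Finset.sum_apply, Finset.sum_eq_single a]
  · simp [slot, read, tailProj]
  · intro b _ hb
    simp [slot, Pi.single_eq_of_ne hb.symm]
  · simp

lemma trace_tailProj [FiniteDimensional ℂ M] {β : I →₀ ℕ} (h : ρ.HasDim β) :
    LinearMap.trace ℂ _ (ρ.tailProj i) = ∑ a ∈ inArrows i, (β (tail a) : ℂ) := by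
  classical
  rw [hasDim_iff_trace] at h
  rw [← sum_slot_read, map_sum]
  refine Finset.sum_congr rfl fun a ha => ?_
  rw [LinearMap.trace_comp_comm', LinearMap.comp_assoc, ← h]
  congr 1
  ext m
  simp [slot, read, mem_inArrows.1 ha]

/-- The value is the coordinate of s_i(β) at i. -/
lemma trace_kerProj [FiniteDimensional ℂ M] (hi : lam i ≠ 0) {β : I →₀ ℕ} (h : ρ.HasDim β) :
    LinearMap.trace ℂ _ (ρ.kerProj i) = ∑ a ∈ inArrows i, (β (tail a) : ℂ) - β i := by
  rw [kerProj, map_sub, trace_tailProj ρ h, map_smul, LinearMap.trace_comp_comm',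
    collect_comp_spread, map_smul, inv_smul_smul₀ hi, (hasDim_iff_trace ρ).1 h]

variable (i) in
/-- The reflection of a weight. -/
def reflectWeight (lam : I → ℂ) (j : I) : ℂ :=
  lam j - symForm (simpleRoot i) (simpleRoot j) * lam i

lemma reflectWeight_of_ne {j : I} (h : i ≠ j) [DecidableEq I] : reflectWeight i lam j =
    lam j + ∑ a ∈ inArrows j, if tail a = i then lam i else 0 := by
  rw [reflectWeight, symForm_simpleRoot]
  simp only [simpleRoot, Finsupp.single_apply, h, if_false, mul_zero, zero_sub, Int.cast_neg,
    neg_mul, sub_neg_eq_add, Int.cast_sum, Finset.sum_mul, Int.cast_ite, Int.cast_one,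
    Int.cast_zero, ite_mul, one_mul, zero_mul, eq_comm (a := i)]

/-- The reflection of weights is dual to s_i: the right-hand side is λ · s_i(β). -/
lemma pairing_reflectWeight (i : I) (lam : I → ℂ) (β : I →₀ ℕ) :
    pairing (reflectWeight i lam) β =
      pairing lam β - symForm (toIntVec β) (simpleRoot i) * lam i := by
  rw [symForm_comm, symForm_toIntVec_right, pairing, pairing, Finsupp.sum, Finsupp.sum,
    Int.cast_sum, Finset.sum_mul, ← Finset.sum_sub_distrib]
  refine Finset.sum_congr rfl fun j _ => ?_
  rw [reflectWeight]
  push_cast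
  ring

variable [DefiniteQuiver I]

lemma reflectWeight_self : reflectWeight i lam i = -lam i := by
  rw [reflectWeight, symForm_simpleRoot_self]
  push_cast
  ring

open Classical in
/-- The operators of the reflected representation. -/
def reflection (hi : lam i ≠ 0) :
    MomentOperators (reflectWeight i lam) (M × Neighbours M i) where
  -- Away from i nothing changes; the space at i becomes the kernel of `collect`. Arrows out of i
  -- read off a component, and arrows into i insert one and project to the kernel. The factor -(±
  -- λ_i) on the latter is forced by the new relation at i, whose weight is -λ_i.
  e j := blockMatrix (if j = i then 0 else ρ.e j) 0 0 (if j = i then ρ.kerProj i else 0)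
  x a := blockMatrix (if head a = i ∨ tail a = i then 0 else ρ.x a)
    (ρ.e (head a) ∘ₗ read i (reverseArrow a) ∘ₗ ρ.kerProj i)
    (-(arrowSign a * lam i) • ρ.kerProj i ∘ₗ slot i a ∘ₗ ρ.e (tail a)) 0
  e_mul_self j := by
    rw [blockMatrix_mul]
    split_ifs
    · simp [ρ.kerProj_mul_self hi]
    · simp [ρ.e_mul_self]
  e_mul_of_ne j k h := by
    rw [blockMatrix_mul, ← blockMatrix_zero]
    split_ifs with h1 h2 h2
    · exact (h (h1.trans h2.symm)).elim
    · simp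
    · simp
    · simp [ρ.e_mul_of_ne j k h]
  e_head_mul a := by
    have hne := tail_ne_head a
    rw [blockMatrix_mul]
    by_cases h : head a = i
    · have ht : head (reverseArrow a) ≠ i := fun h' => hne (h'.trans h.symm)
      simp only [h, read_eq_zero ht, if_true, true_or, LinearMap.zero_comp, LinearMap.comp_zero,
        mul_zero, add_zero, zero_add, LinearMap.comp_smul, smul_zero, ← LinearMap.comp_assoc]
      rw [← Module.End.mul_eq_comp, ρ.kerProj_mul_self hi]
    · simp only [h, slot_eq_zero h, if_false, false_or, LinearMap.zero_comp, LinearMap.comp_zero,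
        mul_zero, add_zero, smul_zero, ← LinearMap.comp_assoc]
      rw [← Module.End.mul_eq_comp (ρ.e _) (ρ.e _), ρ.e_mul_self]
      split_ifs
      · rw [mul_zero]
      · rw [ρ.e_head_mul]
  mul_e_tail a := by
    have hne := tail_ne_head a
    rw [blockMatrix_mul]
    by_cases h : tail a = i
    · have ht : head a ≠ i := fun h' => hne (h.trans h'.symm)
      simp only [h, slot_eq_zero ht, if_true, or_true, LinearMap.zero_comp, LinearMap.comp_zero,
        mul_zero, zero_mul, add_zero, zero_add, smul_zero, LinearMap.comp_assoc]
      rw [← Module.End.mul_eq_comp (ρ.kerProj i) (ρ.kerProj i), ρ.kerProj_mul_self hi]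
    · have ht : head (reverseArrow a) ≠ i := h
      simp only [h, read_eq_zero ht, if_false, or_false, LinearMap.zero_comp, LinearMap.comp_zero,
        mul_zero, add_zero, LinearMap.smul_comp, LinearMap.comp_assoc]
      rw [← Module.End.mul_eq_comp (ρ.e _) (ρ.e _), ρ.e_mul_self]
      split_ifs
      · rw [zero_mul]
      · rw [ρ.mul_e_tail]
  moment j := by
    by_cases hj : j = i
    · subst hj
      rw [reflectWeight_self, smul_blockMatrix]
      have h1 : ∀ a ∈ inArrows j, arrowSign a • (blockMatrix
            (if head a = j ∨ tail a = j then 0 else ρ.x a)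
            (ρ.e (head a) ∘ₗ read j (reverseArrow a) ∘ₗ ρ.kerProj j)
            (-(arrowSign a * lam j) • ρ.kerProj j ∘ₗ slot j a ∘ₗ ρ.e (tail a)) 0 *
          blockMatrix (if head (reverseArrow a) = j ∨ tail (reverseArrow a) = j then 0
              else ρ.x (reverseArrow a))
            (ρ.e (head (reverseArrow a)) ∘ₗ read j (reverseArrow (reverseArrow a)) ∘ₗ
              ρ.kerProj j)
            (-(arrowSign (reverseArrow a) * lam j) • ρ.kerProj j ∘ₗ slot j (reverseArrow a) ∘ₗ
              ρ.e (tail (reverseArrow a))) 0) =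
          blockMatrix 0 0 0 ((-lam j) • (ρ.kerProj j ∘ₗ
            (slot j a ∘ₗ ρ.e (tail a) ∘ₗ read j a) ∘ₗ ρ.kerProj j)) := by
        intro a ha
        have h := mem_inArrows.1 ha
        have ht : head (reverseArrow a) ≠ j := fun h' => tail_ne_head a (h'.trans h.symm)
        rw [blockMatrix_mul, smul_blockMatrix]
        simp only [h, head_reverseArrow, tail_reverseArrow, reverseArrow_reverseArrow,
          slot_eq_zero ht, read_eq_zero ht, true_or, or_true, if_true, LinearMap.zero_comp,
          LinearMap.comp_zero, mul_zero, add_zero, smul_zero, LinearMap.smul_comp,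
          LinearMap.comp_assoc, smul_smul]
        have h2 : arrowSign a * -(arrowSign a * lam j) = -lam j := by
          rw [mul_neg, ← mul_assoc, arrowSign_mul_self, one_mul]
        have h3 : ρ.e (tail a) ∘ₗ ρ.e (tail a) ∘ₗ read j a ∘ₗ ρ.kerProj j =
            ρ.e (tail a) ∘ₗ read j a ∘ₗ ρ.kerProj j := by
          rw [← LinearMap.comp_assoc, ← Module.End.mul_eq_comp, ρ.e_mul_self]
        rw [h2, h3]
      rw [Finset.sum_congr rfl h1, sum_blockMatrix, ← Finset.smul_sum, ← linearMap_comp_sum,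
        ← linearMap_sum_comp, sum_slot_read, ← LinearMap.comp_assoc,
        ← Module.End.mul_eq_comp (ρ.kerProj j) (ρ.tailProj j), kerProj_mul_tailProj,
        ← Module.End.mul_eq_comp, ρ.kerProj_mul_self hi]
      simp only [if_true, Finset.sum_const_zero, smul_zero]
    · rw [reflectWeight_of_ne (Ne.symm hj), smul_blockMatrix]
      -- At j ≠ i an arrow with tail i keeps its old contribution to the relation and adds λ_i e_j;
      -- this is precisely the change of the weight at j.
      have h1 : ∀ a ∈ inArrows j, arrowSign a • (blockMatrix
            (if head a = i ∨ tail a = i then 0 else ρ.x a)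
            (ρ.e (head a) ∘ₗ read i (reverseArrow a) ∘ₗ ρ.kerProj i)
            (-(arrowSign a * lam i) • ρ.kerProj i ∘ₗ slot i a ∘ₗ ρ.e (tail a)) 0 *
          blockMatrix (if head (reverseArrow a) = i ∨ tail (reverseArrow a) = i then 0
              else ρ.x (reverseArrow a))
            (ρ.e (head (reverseArrow a)) ∘ₗ read i (reverseArrow (reverseArrow a)) ∘ₗ
              ρ.kerProj i)
            (-(arrowSign (reverseArrow a) * lam i) • ρ.kerProj i ∘ₗ slot i (reverseArrow a) ∘ₗ
              ρ.e (tail (reverseArrow a))) 0) =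
          blockMatrix (arrowSign a • (ρ.x a * ρ.x (reverseArrow a)) +
            (if tail a = i then lam i else 0) • ρ.e j) 0 0 0 := by
        intro a ha
        have h : head a ≠ i := fun h' => hj ((mem_inArrows.1 ha).symm.trans h')
        have hj' := mem_inArrows.1 ha
        rw [blockMatrix_mul, smul_blockMatrix]
        simp only [h, head_reverseArrow, tail_reverseArrow, reverseArrow_reverseArrow,
          slot_eq_zero h, read_eq_zero h, false_or, or_false, LinearMap.zero_comp,
          LinearMap.comp_zero, add_zero, zero_add, smul_zero]
        by_cases ht : tail a = i
        · have h2 := ρ.read_comp_kerProj_comp_slot (a := reverseArrow a) ht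
          have h3 : (ρ.e (head a) ∘ₗ read i (reverseArrow a) ∘ₗ ρ.kerProj i) ∘ₗ
              (ρ.kerProj i ∘ₗ slot i (reverseArrow a) ∘ₗ ρ.e (head a)) =
              ρ.e (head a) * (read i (reverseArrow a) ∘ₗ ρ.kerProj i ∘ₗ
                slot i (reverseArrow a)) * ρ.e (head a) := by
            conv_rhs => rw [← ρ.kerProj_mul_self hi]
            rfl
          have h4 : ρ.e (head a) * (ρ.x a * ρ.x (reverseArrow a)) * ρ.e (head a) =
              ρ.x a * ρ.x (reverseArrow a) := by
            rw [← mul_assoc, ρ.e_head_mul, mul_assoc]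
            exact congrArg (ρ.x a * ·) (ρ.mul_e_tail (reverseArrow a))
          have h5 : lam i * ((lam i)⁻¹ * arrowSign a) = arrowSign a := by
            rw [← mul_assoc, mul_inv_cancel₀ hi, one_mul]
          simp only [ht, if_true, mul_zero, zero_add, LinearMap.comp_smul]
          rw [h3, h2]
          simp only [tail_reverseArrow, reverseArrow_reverseArrow, arrowSign_reverseArrow,
            mul_sub, sub_mul, ρ.e_mul_self, mul_smul_comm, smul_mul_assoc, h4, smul_sub,
            smul_smul]
          have h6 : arrowSign a * -(-arrowSign a * lam i) = lam i := by
            linear_combination lam i * arrowSign_mul_self a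
          have h7 : arrowSign a * (-(-arrowSign a * lam i) * ((lam i)⁻¹ * -arrowSign a)) =
              -arrowSign a := by
            rw [← mul_assoc, h6]
            linear_combination -h5
          rw [h6, h7, ← hj', neg_smul, sub_neg_eq_add, add_comm, smul_zero]
        · have ht' : head (reverseArrow a) ≠ i := ht
          simp [ht, read_eq_zero ht']
      rw [Finset.sum_congr rfl h1, sum_blockMatrix, Finset.sum_add_distrib, ρ.moment,
        ← Finset.sum_smul, ← add_smul]
      simp [hj]

theorem exists_reflection [FiniteDimensional ℂ M] (hi : lam i ≠ 0) {β : I →₀ ℕ}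
    (h : ρ.HasDim β) (hβ : symForm (toIntVec β) (simpleRoot i) = -1) :
    ∃ (n : ℕ) (σ : MomentRep (reflectWeight i lam) (Fin n → ℂ)),
      σ.HasDim (β + Finsupp.single i 1) := by
  classical
  have hs : ∀ j, j ∉ insert i ρ.vertices → (ρ.reflection hi).e j = 0 := by
    intro j hj
    have hne : j ≠ i := fun h => hj (by simp [h])
    have hj' : j ∉ ρ.vertices := fun h => hj (by simp [h])
    simp [reflection, hne, ρ.e_eq_zero hj', blockMatrix_zero]
  have hdim : ((ρ.reflection hi).toMomentRep hs).HasDim (β + Finsupp.single i 1) := by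
    refine MomentOperators.hasDim_toMomentRep _ hs fun j => ?_
    rw [reflection, trace_blockMatrix]
    by_cases hj : j = i
    · subst hj
      rw [if_pos rfl, if_pos rfl, map_zero, zero_add, ρ.trace_kerProj hi h]
      rw [symForm_simpleRoot] at hβ
      have : (∑ a ∈ inArrows j, (β (tail a) : ℂ)) =
          ((∑ a ∈ inArrows j, toIntVec β (tail a) : ℤ) : ℂ) := by simp
      -- This is the condition (β, ε_i) = -1; subtracting β_i leaves β_i + 1.
      rw [this, show (∑ a ∈ inArrows j, toIntVec β (tail a)) = 2 * toIntVec β j + 1 by lia]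
      simp
      ring
    · simp [hj, (hasDim_iff_trace ρ).1 h]
  -- Choosing a basis returns to a standard space, so carriers and universes do not grow in the
  -- induction.
  exact ⟨_, _, hdim.congr (Module.finBasis ℂ _).equivFun⟩

end Reflection

variable [DefiniteQuiver I]

lemma reflectWeight_reflectWeight (i : I) (lam : I → ℂ) :
    reflectWeight i (reflectWeight i lam) = lam := by
  ext j
  rw [reflectWeight, reflectWeight_self, reflectWeight]
  ring

/-- Every positive root orthogonal to the weight is the dimension vector of a representation. -/
theorem exists_hasDim {lam : I → ℂ} {α : I →₀ ℕ} (hα : IsPositiveRoot α)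
    (h : pairing lam α = 0) : ∃ (n : ℕ) (ρ : MomentRep lam (Fin n → ℂ)), ρ.HasDim α := by
  rw [isPositiveRoot_iff] at hα
  induction hn : α.sum (fun _ n => n) using Nat.strong_induction_on generalizing α lam with
  | _ n ih =>
    obtain ⟨i, rfl | ⟨β, rfl, hβ, hi⟩⟩ := exists_add_single hα
    · rw [pairing_single] at h
      exact ⟨_, _, (hasDim_single h).congr (LinearEquiv.funUnique (Fin 1) ℂ ℂ).symm⟩
    · have hlt : (β.sum fun _ n => n) < n := by
        rw [← hn, Finsupp.sum_add_index' (by simp) (by simp), Finsupp.sum_single_index rfl]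
        exact Nat.lt_succ_self _
      rw [pairing_add, pairing_single] at h
      -- If λ_i = 0, the root β is itself orthogonal to λ and a one-dimensional summand at i
      -- suffices. Otherwise β = s_i(α) is orthogonal to the reflected weight, and reflecting a
      -- representation for that weight leads back to λ.
      by_cases hi0 : lam i = 0
      · rw [hi0, add_zero] at h
        obtain ⟨m, ρ, hρ⟩ := ih _ hlt hβ h rfl
        exact ⟨_, _, (hρ.directSum (hasDim_single hi0)).congr (Module.finBasis ℂ _).equivFun⟩
      · have h' : pairing (reflectWeight i lam) β = 0 := by
          rw [pairing_reflectWeight, hi]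
          push_cast
          linear_combination h
        obtain ⟨m, ρ, hρ⟩ := ih _ hlt hβ h' rfl
        have := ρ.exists_reflection (i := i) (by rw [reflectWeight_self]; simpa using hi0) hρ hi
        rwa [reflectWeight_reflectWeight] at this

end MomentRep

end

/-! ### Dimension vectors of simple modules and of composition factors -/

section Modules

variable {I : Type u} [Quiver.{v} I] [LocallyFiniteQuiver I]

namespace MomentRep

variable {lam : I → ℂ} {M : Type*} [AddCommGroup M] [Module ℂ M] [FiniteDimensional ℂ M]
  {ρ : MomentRep lam M} {α : I →₀ ℕ}

/-- The trace of the deformed preprojective relations. -/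
lemma HasDim.pairing_eq_zero (h : ρ.HasDim α) : pairing lam α = 0 := by
  have h1 : LinearMap.trace ℂ M (∑ i ∈ ρ.vertices, lam i • ρ.e i) = pairing lam α := by
    rw [map_sum, pairing, Finsupp.sum_of_support_subset _ h.support_subset _ (by simp)]
    refine Finset.sum_congr rfl fun i _ => ?_
    rw [map_smul, (hasDim_iff_trace ρ).1 h, smul_eq_mul]
  -- The trace of x_a x_{a*} is unchanged when a is reversed while its sign flips, so the sum is its
  -- own negative.
  have h2 : pairing lam α = -pairing lam α := by
    conv_lhs => rw [← h1, ← ρ.sum_arrowsIn_moment subset_rfl, ← sum_arrowsIn_reverse, map_sum]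
    rw [← h1, ← ρ.sum_arrowsIn_moment subset_rfl, map_sum, ← Finset.sum_neg_distrib]
    refine Finset.sum_congr rfl fun a _ => ?_
    rw [map_smul, map_smul, LinearMap.trace_mul_comm, reverseArrow_reverseArrow,
      arrowSign_reverseArrow, neg_smul]
  linear_combination h2 / 2

lemma HasDim.finrank_eq (h : ρ.HasDim α) : Module.finrank ℂ M = α.degree := by
  have h1 : (Module.finrank ℂ M : ℂ) = (α.degree : ℂ) := by
    rw [← LinearMap.trace_one, ← ρ.sum_e, map_sum, Finsupp.degree_apply, Nat.cast_sum,
      Finset.sum_subset h.support_subset fun i _ hi => by simpa using hi]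
    exact Finset.sum_congr rfl fun i _ => (hasDim_iff_trace ρ).1 h i
  exact_mod_cast h1

end MomentRep

variable {lam : I → ℂ} {M : Type*} [AddCommGroup M] [Module ℂ M] [Module (ContPreprojective lam) M]
  [IsScalarTower ℂ (ContPreprojective lam) M]

/-- A finite-dimensional representation that is the sum of finitely many of its vertex spaces has a
dimension vector. -/
lemma exists_hasDimensionVector [FiniteDimensional ℂ M] {s : Finset I}
    (hs : ∑ i ∈ s, moduleAction lam M (idem i) = 1) :
    ∃ α : I →₀ ℕ, HasDimensionVector lam M α := by
  set ρ := MomentRep.ofModule lam M hs with hρ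
  refine ⟨Finsupp.onFinset s (fun i => Module.finrank ℂ (vertexSpace lam M i)) fun i hi => ?_,
    ρ.iSupIndep_range_e, ρ.iSup_range_e, fun i => (Module.finrank_eq_rank _ _).symm⟩
  by_contra h
  refine hi ?_
  have h1 : vertexSpace lam M i = LinearMap.range (ρ.e i) := rfl
  rw [h1, ρ.e_eq_zero h, LinearMap.range_zero, finrank_bot]

lemma range_mkQ_domRestrict (K : Submodule (ContPreprojective lam) M) (i : I) :
    LinearMap.range ((K.mkQ.restrictScalars ℂ).domRestrict (vertexSpace lam M i)) =
      vertexSpace lam (M ⧸ K) i := by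
  ext q
  constructor
  · rintro ⟨⟨_, m, rfl⟩, rfl⟩
    exact ⟨K.mkQ m, (map_smul K.mkQ (vertexIdem lam i) m).symm⟩
  · rintro ⟨q, rfl⟩
    obtain ⟨m, rfl⟩ := K.mkQ_surjective q
    exact ⟨⟨vertexIdem lam i • m, m, rfl⟩, map_smul K.mkQ (vertexIdem lam i) m⟩

lemma vertexIdem_mul_self (i : I) : vertexIdem lam i * vertexIdem lam i = vertexIdem lam i := by
  rw [vertexIdem, ← map_mul, idem_mul_self]

lemma map_ker_mkQ_domRestrict (K : Submodule (ContPreprojective lam) M) (i : I) :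
    (LinearMap.ker ((K.mkQ.restrictScalars ℂ).domRestrict (vertexSpace lam M i))).map
      (vertexSpace lam M i).subtype =
        (vertexSpace lam K i).map (K.subtype.restrictScalars ℂ) := by
  ext m
  constructor
  · rintro ⟨⟨_, m, rfl⟩, hm, rfl⟩
    have hm' : vertexIdem lam i • m ∈ K := (Submodule.Quotient.mk_eq_zero K).1 hm
    refine ⟨⟨vertexIdem lam i • m, hm'⟩, ⟨⟨vertexIdem lam i • m, hm'⟩, Subtype.ext ?_⟩, rfl⟩
    change vertexIdem lam i • vertexIdem lam i • m = vertexIdem lam i • m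
    rw [← mul_smul, vertexIdem_mul_self]
  · rintro ⟨_, ⟨m, rfl⟩, rfl⟩
    refine ⟨⟨vertexIdem lam i • m.1, m.1, rfl⟩, ?_, rfl⟩
    exact (Submodule.Quotient.mk_eq_zero K).2 (K.smul_mem _ m.2)

/-- Cutting by e_i is exact: this is rank–nullity for the quotient map restricted to e_i M. -/
lemma finrank_vertexSpace_submodule_add_quotient [FiniteDimensional ℂ M]
    (K : Submodule (ContPreprojective lam) M) (i : I) :
    Module.finrank ℂ (vertexSpace lam K i) + Module.finrank ℂ (vertexSpace lam (M ⧸ K) i) =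
      Module.finrank ℂ (vertexSpace lam M i) := by
  have h1 := LinearMap.finrank_range_add_finrank_ker
    ((K.mkQ.restrictScalars ℂ).domRestrict (vertexSpace lam M i))
  rw [range_mkQ_domRestrict, add_comm] at h1
  rw [← h1, (Submodule.equivMapOfInjective _ (vertexSpace lam M i).injective_subtype
    (LinearMap.ker _)).finrank_eq, map_ker_mkQ_domRestrict]
  congr 1
  exact (Submodule.equivMapOfInjective (K.subtype.restrictScalars ℂ)
    K.injective_subtype (vertexSpace lam K i)).finrank_eq

namespace HasDimensionVector

variable {α : I →₀ ℕ} (h : HasDimensionVector lam M α)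

include h

lemma ne_zero [Nontrivial M] : α ≠ 0 := by
  rintro rfl
  have := h.sum_idem
  simp at this

lemma nontrivial_of_ne_zero (hα : α ≠ 0) : Nontrivial M := by
  by_contra hM
  rw [not_nontrivial_iff_subsingleton] at hM
  refine hα (Finsupp.ext fun i => ?_)
  have h1 := h.hasDim i
  rwa [Module.finrank_zero_of_subsingleton, eq_comm] at h1

lemma finrank_eq : Module.finrank ℂ M = α.degree :=
  have := h.finiteDimensional
  h.hasDim.finrank_eq

lemma sum_idem_apply (m : M) : ∑ i ∈ α.support, moduleAction lam M (idem i) m = m := by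
  rw [← LinearMap.sum_apply, h.sum_idem, Module.End.one_apply]

lemma sum_idem_submodule (K : Submodule (ContPreprojective lam) M) :
    ∑ i ∈ α.support, moduleAction lam K (idem i) = 1 := by
  refine LinearMap.ext fun m => K.injective_subtype ?_
  rw [LinearMap.sum_apply, Module.End.one_apply, map_sum]
  exact h.sum_idem_apply (K.subtype m)

lemma sum_idem_quotient (K : Submodule (ContPreprojective lam) M) :
    ∑ i ∈ α.support, moduleAction lam (M ⧸ K) (idem i) = 1 := by
  refine LinearMap.ext fun q => ?_
  obtain ⟨m, rfl⟩ := K.mkQ_surjective q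
  have h1 := congrArg K.mkQ (h.sum_idem_apply m)
  rw [map_sum] at h1
  rw [LinearMap.sum_apply, Module.End.one_apply]
  refine Eq.trans (Finset.sum_congr rfl fun i _ => ?_) h1
  exact (map_smul K.mkQ (vertexIdem lam i) m).symm

lemma finiteDimensional_submodule (K : Submodule (ContPreprojective lam) M) :
    FiniteDimensional ℂ K :=
  have := h.finiteDimensional
  FiniteDimensional.of_injective (K.subtype.restrictScalars ℂ) K.injective_subtype

lemma finiteDimensional_quotient (K : Submodule (ContPreprojective lam) M) :
    FiniteDimensional ℂ (M ⧸ K) :=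
  have := h.finiteDimensional
  Module.Finite.of_surjective (K.mkQ.restrictScalars ℂ) K.mkQ_surjective

/-- The dimension vectors of a subrepresentation and of the quotient. -/
lemma exists_submodule_quotient (K : Submodule (ContPreprojective lam) M) :
    ∃ β γ : I →₀ ℕ, HasDimensionVector lam K β ∧ HasDimensionVector lam (M ⧸ K) γ ∧
      β + γ = α := by
  have := h.finiteDimensional
  have := h.finiteDimensional_submodule K
  have := h.finiteDimensional_quotient K
  obtain ⟨β, hβ⟩ := exists_hasDimensionVector (h.sum_idem_submodule K)
  obtain ⟨γ, hγ⟩ := exists_hasDimensionVector (h.sum_idem_quotient K)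
  refine ⟨β, γ, hβ, hγ, Finsupp.ext fun i => ?_⟩
  have h1 := finrank_vertexSpace_submodule_add_quotient (lam := lam) K i
  rw [Module.finrank_eq_of_rank_eq (hβ.rank_eq i), Module.finrank_eq_of_rank_eq (hγ.rank_eq i),
    Module.finrank_eq_of_rank_eq (h.rank_eq i)] at h1
  exact h1

variable {N : Type*} [AddCommGroup N] [Module ℂ N] [Module (ContPreprojective lam) N]
  [IsScalarTower ℂ (ContPreprojective lam) N] {β : I →₀ ℕ} (h' : HasDimensionVector lam N β)


/-- A homomorphism of representations as a linear map over the algebra. -/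
def toLinearMap (h : HasDimensionVector lam M α) (h' : HasDimensionVector lam N β)
    {f : M →ₗ[ℂ] N} (hf : f ∈ MomentRep.homSpace h.toMomentRep h'.toMomentRep) :
    M →ₗ[ContPreprojective lam] N :=
  { f with map_smul' := h.map_smul_of_commute h' f hf.1 hf.2 }

include h' in
-- Otherwise both homomorphism spaces in `MomentRep.symForm_le` vanish. The direction of the map is
-- not under control, so users treat both.
lemma exists_linearMap_ne_zero (hpos : 0 < symForm (toIntVec α) (toIntVec β)) :
    (∃ f : M →ₗ[ContPreprojective lam] N, f ≠ 0) ∨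
      ∃ f : N →ₗ[ContPreprojective lam] M, f ≠ 0 := by
  have := h.finiteDimensional
  have := h'.finiteDimensional
  by_contra! hzero
  have h1 : MomentRep.homSpace h.toMomentRep h'.toMomentRep = ⊥ := by
    rw [Submodule.eq_bot_iff]
    intro f hf
    ext m
    exact LinearMap.congr_fun (hzero.1 (toLinearMap h h' hf)) m
  have h2 : MomentRep.homSpace h'.toMomentRep h.toMomentRep = ⊥ := by
    rw [Submodule.eq_bot_iff]
    intro f hf
    ext m
    exact LinearMap.congr_fun (hzero.2 (toLinearMap h' h hf)) m
  have h3 := MomentRep.symForm_le h.hasDim h'.hasDim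
  rw [h1, h2, finrank_bot, finrank_bot] at h3
  simp at h3
  lia

/-- By Schur's lemma over ℂ the endomorphisms are scalars, and the bound is twice the dimension of
the endomorphism space. -/
lemma symForm_le_two [IsSimpleModule (ContPreprojective lam) M] :
    symForm (toIntVec α) (toIntVec α) ≤ 2 := by
  have := h.finiteDimensional
  have h1 : Module.finrank ℂ (MomentRep.homSpace h.toMomentRep h.toMomentRep) ≤ 1 := by
    have h2 : MomentRep.homSpace h.toMomentRep h.toMomentRep ≤ ℂ ∙ (LinearMap.id : M →ₗ[ℂ] M) := by
      intro f hf
      obtain ⟨c, hc⟩ := (IsSimpleModule.algebraMap_end_bijective_of_isAlgClosed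
        (A := ContPreprojective lam) (V := M) ℂ).2 (toLinearMap h h hf)
      rw [Submodule.mem_span_singleton]
      refine ⟨c, ?_⟩
      ext m
      exact LinearMap.congr_fun hc m
    exact (Submodule.finrank_mono h2).trans ((finrank_span_le_card _).trans (by simp))
  have h3 := MomentRep.symForm_le h.hasDim h.hasDim
  lia

lemma pairing_eq_zero : pairing lam α = 0 :=
  have := h.finiteDimensional
  h.hasDim.pairing_eq_zero

variable [DefiniteQuiver I]

lemma isPositiveRoot [IsSimpleModule (ContPreprojective lam) M] : IsPositiveRoot α := by
  have : Nontrivial M := IsSimpleModule.nontrivial (ContPreprojective lam) M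
  rw [isPositiveRoot_iff]
  refine le_antisymm h.symForm_le_two (two_le_symForm_self fun h0 => ?_)
  exact h.ne_zero (toIntVec_injective (h0.trans toIntVec_zero.symm))

lemma nonempty_linearEquiv (h' : HasDimensionVector lam N α)
    [IsSimpleModule (ContPreprojective lam) M]
    [IsSimpleModule (ContPreprojective lam) N] :
    Nonempty (M ≃ₗ[ContPreprojective lam] N) := by
  have hpos : 0 < symForm (toIntVec α) (toIntVec α) := by
    rw [isPositiveRoot_iff.1 h.isPositiveRoot]; exact two_pos
  rcases h.exists_linearMap_ne_zero h' hpos with ⟨f, hf⟩ | ⟨f, hf⟩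
  · exact ⟨LinearEquiv.ofBijective f (LinearMap.bijective_of_ne_zero hf)⟩
  · exact ⟨(LinearEquiv.ofBijective f (LinearMap.bijective_of_ne_zero hf)).symm⟩

/-- Some representation has dimension vector β; a nonzero map from or to it makes the simple M a
subobject or a quotient, and the degree is the total dimension. -/
lemma degree_le_of_symForm_pos [IsSimpleModule (ContPreprojective lam) M] {β : I →₀ ℕ}
    (hβ : IsPositiveRoot β) (hβ0 : pairing lam β = 0)
    (hpos : 0 < symForm (toIntVec α) (toIntVec β)) : α.degree ≤ β.degree := by
  obtain ⟨n, σ, hσ⟩ := MomentRep.exists_hasDim hβ hβ0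
  let := σ.toModule
  obtain ⟨_, h'⟩ := σ.hasDimensionVector hσ
  have := h.finiteDimensional
  rw [← h.finrank_eq, ← h'.finrank_eq]
  rcases h.exists_linearMap_ne_zero h' hpos with ⟨f, hf⟩ | ⟨f, hf⟩
  · have := h'.finiteDimensional
    have hinj : Function.Injective f := LinearMap.injective_of_ne_zero hf
    exact LinearMap.finrank_le_finrank_of_injective (f := f.restrictScalars ℂ) hinj
  · have := h'.finiteDimensional
    have hsurj : Function.Surjective f := LinearMap.surjective_of_ne_zero hf
    exact (f.restrictScalars ℂ).finrank_le_finrank_of_surjective hsurj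

/-- The dimension vector of a simple representation is not a sum of several positive roots that are
orthogonal to the weight. -/
lemma not_decomposable [IsSimpleModule (ContPreprojective lam) M] {n : ℕ} {β : Fin n → I →₀ ℕ}
    (hn : 2 ≤ n) (hβ : ∀ k, IsPositiveRoot (β k) ∧ pairing lam (β k) = 0) :
    ∑ k, β k ≠ α := by
  intro hsum
  have h1 := isPositiveRoot_iff.1 h.isPositiveRoot
  -- The numbers (α, β_k) add up to (α, α) = 2.
  obtain ⟨k, hk⟩ : ∃ k, 0 < symForm (toIntVec α) (toIntVec (β k)) := by
    by_contra! hle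
    have h2 : toIntVec α = ∑ k, toIntVec (β k) := by rw [← hsum, toIntVec_sum]
    conv_lhs at h1 => rw [← symFormBilin_apply]; arg 2; rw [h2]
    rw [map_sum] at h1
    have := Finset.sum_nonpos fun k (_ : k ∈ Finset.univ) => hle k
    simp only [symFormBilin_apply] at h1
    lia
  have h2 := h.degree_le_of_symForm_pos (hβ k).1 (hβ k).2 hk
  have : Nontrivial (Fin n) := Fin.nontrivial_iff_two_le.2 hn
  obtain ⟨l, hl⟩ := exists_ne k
  have h3 : α.degree = ∑ k, (β k).degree := by rw [← hsum, map_sum]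
  -- A second nonzero summand makes the degree of β_k strictly smaller than that of α.
  have h4 : (β k).degree + (β l).degree ≤ ∑ k, (β k).degree := by
    rw [← Finset.sum_pair (f := fun k => (β k).degree) hl.symm]
    exact Finset.sum_le_sum_of_subset (Finset.subset_univ _)
  have h5 : (β l).degree ≠ 0 := by
    rw [Ne, Finsupp.degree_eq_zero_iff]
    exact (hβ l).1.ne_zero
  lia

end HasDimensionVector

/-- The dimension vectors of the composition factors. -/
theorem HasDimensionVector.exists_list [DefiniteQuiver I] {lam : I → ℂ} {M : Type w} [AddCommGroup M] [Module ℂ M] [Module (ContPreprojective lam) M]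
    [IsScalarTower ℂ (ContPreprojective lam) M] {α : I →₀ ℕ} (h : HasDimensionVector lam M α)
    (hα : α ≠ 0) :
    ∃ l : List (I →₀ ℕ), (∀ β ∈ l, IsPositiveRoot β ∧ pairing lam β = 0) ∧ l.sum = α ∧
      (IsSimpleModule (ContPreprojective lam) M ∨ 2 ≤ l.length) := by
  induction hd : α.degree using Nat.strong_induction_on generalizing α M with
  | _ d ih =>
    have := h.nontrivial_of_ne_zero hα
    by_cases hs : IsSimpleModule (ContPreprojective lam) M
    · exact ⟨[α], by simpa using ⟨h.isPositiveRoot, h.pairing_eq_zero⟩, by simp, Or.inl hs⟩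
    · obtain ⟨K, hK0, hK1⟩ : ∃ K : Submodule (ContPreprojective lam) M, K ≠ ⊥ ∧ K ≠ ⊤ := by
        by_contra! hK
        exact hs ((isSimpleModule_iff _ _).2 { eq_bot_or_eq_top := fun K => or_iff_not_imp_left.2 (hK K) })
      -- Both K and M ⧸ K are nonzero of smaller dimension, so their lists are nonempty and the
      -- concatenation has length at least 2.
      obtain ⟨β, γ, hβ, hγ, rfl⟩ := h.exists_submodule_quotient K
      have := (Submodule.nontrivial_iff_ne_bot).2 hK0
      have : Nontrivial (M ⧸ K) := Submodule.Quotient.nontrivial_iff.2 hK1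
      have hβ0 := hβ.ne_zero
      have hγ0 := hγ.ne_zero
      have h1 : β.degree ≠ 0 := by rwa [Ne, Finsupp.degree_eq_zero_iff]
      have h2 : γ.degree ≠ 0 := by rwa [Ne, Finsupp.degree_eq_zero_iff]
      rw [map_add] at hd
      obtain ⟨l, hl, hl', -⟩ := ih β.degree (by lia) hβ hβ0 rfl
      obtain ⟨m, hm, hm', -⟩ := ih γ.degree (by lia) hγ hγ0 rfl
      refine ⟨l ++ m, fun δ hδ => (List.mem_append.1 hδ).elim (hl δ) (hm δ), by simp [hl', hm'],
        Or.inr ?_⟩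
      have h3 : l ≠ [] := by rintro rfl; exact hβ0 hl'.symm
      have h4 : m ≠ [] := by rintro rfl; exact hγ0 hm'.symm
      have := List.length_pos_of_ne_nil h3
      have := List.length_pos_of_ne_nil h4
      rw [List.length_append]
      lia

end Modules

end InfQuiver

end

/-! ### The main theorem -/

theorem corollary6p2 {I : Type u} [Quiver.{v} I] (hQ : IsInfiniteAffine I)
    (lam : I → ℂ) (α : I →₀ ℕ) :
    ((∃ (M : Type w) (_ : AddCommGroup M) (_ : Module ℂ M) (_ : Module (ContPreprojective lam) M)
        (_ : IsScalarTower ℂ (ContPreprojective lam) M),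
        IsSimpleModule (ContPreprojective lam) M ∧ HasDimensionVector lam M α) ↔
      (IsFiniteTypeRoot lam α ∧
        ∀ (n : ℕ) (β : Fin n → (I →₀ ℕ)), 2 ≤ n →
          (∀ k, IsPositiveRoot (β k) ∧ pairing lam (β k) = 0) → ∑ k, β k = α →
          ∑ k, pFun (β k) < pFun α)) ∧
    ∀ (M : Type w) [AddCommGroup M] [Module ℂ M] [Module (ContPreprojective lam) M]
      [IsScalarTower ℂ (ContPreprojective lam) M]
      (N : Type w') [AddCommGroup N] [Module ℂ N] [Module (ContPreprojective lam) N]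
      [IsScalarTower ℂ (ContPreprojective lam) N],
      IsSimpleModule (ContPreprojective lam) M → HasDimensionVector lam M α →
      IsSimpleModule (ContPreprojective lam) N → HasDimensionVector lam N α →
      Nonempty (M ≃ₗ[ContPreprojective lam] N) := by
  obtain ⟨_, _⟩ := hQ.locallyFinite_and_definite
  refine ⟨⟨?_, ?_⟩, ?_⟩
  · rintro ⟨M, _, _, _, _, _, h⟩
    exact ⟨isFiniteTypeRoot_iff.2 ⟨h.isPositiveRoot, h.pairing_eq_zero⟩,
      -- The inequality holds vacuously, as no such decomposition exists.
      fun n β hn hβ hsum => (h.not_decomposable hn hβ hsum).elim⟩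
  · rintro ⟨hα, hmin⟩
    obtain ⟨hα, hα0⟩ := isFiniteTypeRoot_iff.1 hα
    obtain ⟨n, ρ, hρ⟩ := MomentRep.exists_hasDim hα hα0
    -- The module is required in an arbitrary universe, so the standard space is lifted.
    have hσ := hρ.congr (ULift.moduleEquiv.{0, 0, w} (R := ℂ) (M := Fin n → ℂ)).symm
    let := MomentRep.toModule (ρ.congr (ULift.moduleEquiv.{0, 0, w} (R := ℂ) (M := Fin n → ℂ)).symm)
    obtain ⟨_, h⟩ := MomentRep.hasDimensionVector _ hσ
    refine ⟨ULift.{w} (Fin n → ℂ), inferInstance, inferInstance, inferInstance, inferInstance, ?_, h⟩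
    obtain ⟨l, hl, hsum, hs | hlen⟩ := h.exists_list hα.ne_zero
    · exact hs
    · have hl' : ∀ k : Fin l.length, IsPositiveRoot l[k] ∧ pairing lam l[k] = 0 :=
        fun k => hl _ (List.getElem_mem _)
      have := hmin l.length (fun k => l[k]) hlen hl' (by
        rw [← hsum, ← List.sum_ofFn]; simp)
      -- Since p vanishes on all positive roots, a list of two or more factors would give 0 < 0.
      rw [Finset.sum_eq_zero fun k _ => (hl' k).1.pFun_eq_zero, hα.pFun_eq_zero] at this
      exact (lt_irrefl _ this).elim
  · intro M _ _ _ _ N _ _ _ _ _ hM _ hN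
    exact HasDimensionVector.nonempty_linearEquiv hM hN
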